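/- Let $n\ge 1$ and $\nu\ge 2$. A birational involution of $\mathbb P_n=\mathbb P_n(\mathbb C)$ is a rational map $I:\mathbb P_n\dashrightarrow\mathbb P_n$ with $I\circ I=\mathrm{id}$ and $I\neq \mathrm{id}$. For birational involutions $I_1,\dots,I_\nu$ let $\Gamma=\langle I_1,\dots,I_\nu\rangle$ be the group of birational transformations that they generate. A non-trivial invariant of $\Gamma$ is a non-constant rational function $\Delta=P/Q$ on $\mathbb P_n$ ($P,Q$ forms of the same degree) with $\Delta(g(x))=\Delta(x)$ for all $g\in\Gamma$; its degree is the degree of $P$ and $Q$ in lowest terms. The space of $\nu$-tuples of birational involutions of $\mathbb P_n$ carries its Zariski topology: a set is closed if, for each multidegree $(d_1,\dots,d_\nu)$, among the tuples of involutions given by forms of degrees $d_1,\dots,d_\nu$ (common factors allowed), it is defined by polynomial equations in the coefficients of these forms. "Very general" means: outside of the union of countably many proper algebraic subsets of the (affine) parameter space. **Theorem.** The group $\Gamma$ generated by a generic tuple of birational involutions of $\mathbb P_n$ does not admit any non-trivial invariant. Precisely: 1. For every $m$, the set of tuples $(I_1,\dots,I_\nu)$ whose group $\Gamma$ admits a non-trivial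 invariant of degree at most $m$ is Zariski closed. 2. There is an algebraic family $(g_t)_{t\in\mathbb C^N}$ of birational transformations of $\mathbb P_n$, containing the identity (that is, $g_t$ and $g_t^{-1}$ are given by forms of fixed degrees in $x_0,\dots,x_n$ whose coefficients are polynomials in $t$), such that for all birational involutions $I_1,\dots,I_\nu$ of $\mathbb P_n$ and very general $(t_1,\dots,t_\nu)\in(\mathbb C^N)^\nu$, the group generated by the birational involutions $g_{t_1}^{-1}I_1g_{t_1},\dots,g_{t_\nu}^{-1}I_\nu g_{t_\nu}$ admits no non-trivial invariant. In particular the set of tuples without non-trivial invariant is dense, and by (1) it is the intersection, over $m$, of the dense open sets of tuples without non-trivial invariant of degree at most $m$. 3. For the Hadamard inversion $J:[x_0:\dots:x_n]\mapsto[1/x_0:\dots:1/x_n]$ and a very general tuple of matrices $C_1,\dots,C_\nu$ of size $n+1$, all $C_k$ are invertible and the collineated group generated by the involutions $C_1^{-1}JC_1,\dots,C_\nu^{-1}JC_\nu$ admits no non-trivial invariant. -/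

import Mathlib

namespace Cremona

open MvPolynomial

/-- `(n+1)`-tuples of polynomials in the homogeneous coordinates `x₀, …, xₙ`, with coefficients
in `R`.  When the entries are homogeneous of one degree and not all zero, such a tuple over `ℂ`
describes a rational map `ℙₙ ⇢ ℙₙ`. Common factors of the entries are allowed. -/
abbrev Forms (n : ℕ) (R : Type) [CommSemiring R] : Type :=
  Fin (n + 1) → MvPolynomial (Fin (n + 1)) R

/-- The identity of `ℙₙ` in homogeneous coordinates. -/
noncomputable def ident (n : ℕ) : Forms n ℂ := fun i => X i

/-- Composition of rational maps: `(comp F G)(x) = F(G(x))`. -/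
noncomputable def comp {n : ℕ} (F G : Forms n ℂ) : Forms n ℂ := fun i => bind₁ G (F i)

/-- Two nonzero tuples describe the same rational map when they are proportional
over the field of rational functions. -/
def SameMap {n : ℕ} (F G : Forms n ℂ) : Prop :=
  F ≠ 0 ∧ G ≠ 0 ∧ ∀ i j, F i * G j = F j * G i

/-- `F`, given by forms of degree `d`, describes a birational involution of `ℙₙ`, that is, a
rational map with `F ∘ F = id` and `F ≠ id`.  The first condition says that
`F(F(x)) = φ(x) x` for a nonzero polynomial `φ`; so `F` is birational, its own inverse. -/
structure IsInvolution {n : ℕ} (d : ℕ) (F : Forms n ℂ) : Prop where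
  homogeneous : ∀ i, (F i).IsHomogeneous d
  square : SameMap (comp F F) (ident n)
  nontrivial : ¬ SameMap F (ident n)

/-- The elements of the group `Γ` generated by the transformations `I k`. As the
generators are involutions, every element of `Γ` is a word in them. -/
noncomputable def word {n ν : ℕ} (I : Fin ν → Forms n ℂ) : List (Fin ν) → Forms n ℂ
  | [] => ident n
  | k :: w => comp (I k) (word I w)

/-- The rational function `Δ = P / Q` satisfies `Δ(g(x)) = Δ(x)` for every `g` in the group
generated by the `I k`. (For involutions `I k` the composite `Q ∘ g` is never zero, so that
`Δ ∘ g` makes sense.) -/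
def IsInvariant {n ν : ℕ} (I : Fin ν → Forms n ℂ) (P Q : MvPolynomial (Fin (n + 1)) ℂ) : Prop :=
  ∀ w : List (Fin ν), bind₁ (word I w) Q ≠ 0 ∧
    bind₁ (word I w) P * Q = bind₁ (word I w) Q * P

/-- The group generated by the `I k` has a non-constant invariant rational function on `ℙₙ` that
is a quotient of two forms of degree `m`; as these may have common factors, this means a
non-constant invariant of degree at most `m`. -/
def HasNontrivialInvariant {n ν : ℕ} (I : Fin ν → Forms n ℂ) (m : ℕ) : Prop :=
  ∃ P Q : MvPolynomial (Fin (n + 1)) ℂ, P.IsHomogeneous m ∧ Q.IsHomogeneous m ∧ Q ≠ 0 ∧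
    (¬ ∃ c : ℂ, P = C c * Q) ∧ IsInvariant I P Q

/-- The vector of all the coefficients of a `ν`-tuple of transformations. -/
noncomputable def coeffVector {n ν : ℕ} (I : Fin ν → Forms n ℂ) :
    Fin ν × Fin (n + 1) × (Fin (n + 1) →₀ ℕ) → ℂ :=
  fun a => coeff a.2.2 (I a.1 a.2.1)

/-- A property `E` of `ν`-tuples of birational involutions of `ℙₙ` is closed for the Zariski
topology: in each multidegree, among the tuples of birational involutions, it is given by the
vanishing of polynomials in the coefficients. -/
def IsZariskiClosed {n ν : ℕ} (E : (Fin ν → Forms n ℂ) → Prop) : Prop :=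
  ∀ d : Fin ν → ℕ, ∃ S : Set (MvPolynomial (Fin ν × Fin (n + 1) × (Fin (n + 1) →₀ ℕ)) ℂ),
    ∀ I : Fin ν → Forms n ℂ, (∀ k, IsInvolution (d k) (I k)) →
      (E I ↔ ∀ s ∈ S, eval (coeffVector I) s = 0)

/-- `p` holds at the very general point of the affine space `ℂ^σ`: outside of the union of
countably many proper algebraic subsets. -/
def VeryGeneral {σ : Type} (p : (σ → ℂ) → Prop) : Prop :=
  ∃ f : ℕ → MvPolynomial σ ℂ, (∀ j, f j ≠ 0) ∧
    ∀ t : σ → ℂ, (∀ j, eval t (f j) ≠ 0) → p t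

/-- The member at the parameter `t` of a family of tuples of forms whose coefficients are
polynomials in `N` parameters. -/
noncomputable def member {n N : ℕ} (F : Forms n (MvPolynomial (Fin N) ℂ)) (t : Fin N → ℂ) :
    Forms n ℂ :=
  fun i => map (eval t) (F i)

/-- `G` and `H` describe an algebraic family `(g_t)`, `t ∈ ℂ^N`, of birational transformations
of `ℙₙ` and the family of the inverses `g_t⁻¹`; the identity of `ℙₙ` is a member. -/
structure IsBirationalFamily {n N : ℕ} (a b : ℕ) (G H : Forms n (MvPolynomial (Fin N) ℂ)) :
    Prop where
  homogeneous : ∀ i, (G i).IsHomogeneous a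
  homogeneous_inv : ∀ i, (H i).IsHomogeneous b
  left_inv : ∀ t, SameMap (comp (member H t) (member G t)) (ident n)
  right_inv : ∀ t, SameMap (comp (member G t) (member H t)) (ident n)
  exists_ident : ∃ t, SameMap (member G t) (ident n)

/-- The generators `g_t⁻¹ ∘ I k ∘ g_t` where, for each `k`, `t = (s (k, 0), …, s (k, N - 1))`. -/
noncomputable def conjugated {n N ν : ℕ} (G H : Forms n (MvPolynomial (Fin N) ℂ))
    (I : Fin ν → Forms n ℂ) (s : Fin ν × Fin N → ℂ) : Fin ν → Forms n ℂ :=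
  fun k => comp (member H fun l => s (k, l)) (comp (I k) (member G fun l => s (k, l)))

/-- The Hadamard inversion `J : [x₀ : … : xₙ] ⇢ [1/x₀ : … : 1/xₙ]`. -/
noncomputable def hadamard (n : ℕ) : Forms n ℂ := fun i => ∏ j ∈ Finset.univ.erase i, X j

/-- The linear map `x ↦ A x` in homogeneous coordinates. -/
noncomputable def linear {n : ℕ} (A : Matrix (Fin (n + 1)) (Fin (n + 1)) ℂ) : Forms n ℂ :=
  fun i => ∑ j, C (A i j) * X j

/-- The transformation `A⁻¹ K A`, for an invertible matrix `A`. -/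
noncomputable def collineated {n : ℕ} (K : Forms n ℂ)
    (A : Matrix (Fin (n + 1)) (Fin (n + 1)) ℂ) : Forms n ℂ :=
  comp (linear A⁻¹) (comp K (linear A))

end Cremona

/-! ### Elimination theory: the resultant system. -/

namespace Cremona

open MvPolynomial

/-! Invariance of P/Q under F means P(F)Q − Q(F)P = 0. The left side is alternating bilinear in (P,
Q), hence linear in the Plücker coordinates of the pencil spanned by P and Q, and these are not all
zero exactly when P and Q are independent. So an invariant of degree at most m exists iff a system
of forms has a non-trivial zero, and by elimination (`exists_zero_iff_resultants`,
`hasCommonInvariant_iff_resultants`) this is a closed condition on the parameters. For involutions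
it is enough to test the generators (`hasNontrivialInvariant_iff`).

In a family it therefore suffices to find one parameter without invariants: for each m some
resultant is nonzero there, and these countably many polynomials cut out the exceptional set. At
that parameter a single element F of the group already has no invariant, by `eq_C_mul_of_invariant`:
if the F_i have leading monomials x^γ x_i with suitably independent leading coefficients, then
composition with F multiplies the leading coefficient of a form by a factor which determines its
leading exponent.

For the Hadamard inversion, F is the product of J and a diagonal conjugate of J, a diagonal linear
map. For arbitrary involutions, F is a product of two conjugates that fixes a = [1:0:…:0] with
diagonal differential, which suffices by `Jet.exists_degree_lex`. Each involution exchanges two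
independent points; conjugation moves them to a and b = [1:…:1], and the differential of the product
at a is the product of the differentials from a to b and from b to a. Maps that fix a and b, with
trivial differential at a and arbitrary differential of determinant one at b
(`exists_parametrized_shearJet`), prescribe this product up to its determinant, which is adjusted by
changing frames (`IsInvolution.exists_jet_from_translation`). Since SL is a product of boundedly
many one-parameter groups of transvections (`special_linear_bounded_induction`), all these
conjugations lie in one algebraic family, independent of the involutions. -/

/-- The exponents of the monomials of degree `e`. -/
abbrev DegExp (ι : Type) (e : ℕ) : Type := {β : ι →₀ ℕ // β.degree = e}

noncomputable instance {ι : Type} [Finite ι] (e : ℕ) : Fintype (DegExp ι e) := by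
  classical
  haveI := Fintype.ofFinite ι
  refine Fintype.ofFinset (p := fun β : ι →₀ ℕ => β.degree = e)
    (Finset.finsuppAntidiag Finset.univ e) fun β => ?_
  simp [Finset.mem_finsuppAntidiag, Finsupp.degree_eq_sum]
  rfl

noncomputable instance {ι : Type} (e : ℕ) : DecidableEq (DegExp ι e) := Classical.decEq _

lemma sum_support_eq_sum_degExp {ι A M : Type} [Finite ι] [CommSemiring A] [AddCommMonoid M]
    {e : ℕ} {p : MvPolynomial ι A} (hp : p.IsHomogeneous e) (g : (ι →₀ ℕ) → A → M)
    (hg : ∀ β, g β 0 = 0) :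
    ∑ β ∈ p.support, g β (coeff β p) = ∑ β : DegExp ι e, g β (coeff β.1 p) := by
  classical
  rw [← Finset.sum_coe_sort]
  refine Finset.sum_bij_ne_zero (fun β _ _ => ⟨β.1, ?_⟩) (fun _ _ _ => Finset.mem_univ _)
    ?_ ?_ ?_
  · by_contra h
    exact (mem_support_iff.1 β.2) (hp.coeff_eq_zero h)
  · intro a _ _ b _ _ h
    exact Subtype.ext (by simpa using h)
  · intro b _ hb
    refine ⟨⟨b.1, mem_support_iff.2 fun h => hb (by rw [h, hg])⟩, Finset.mem_univ _, hb, rfl⟩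
  · intros; rfl

lemma eval_eq_sum_degExp {ι A : Type} [Fintype ι] [CommSemiring A] {e : ℕ}
    {p : MvPolynomial ι A} (hp : p.IsHomogeneous e) (y : ι → A) :
    eval y p = ∑ β : DegExp ι e, coeff β.1 p * ∏ i, y i ^ β.1 i := by
  rw [eval_eq', sum_support_eq_sum_degExp hp (fun β a => a * ∏ i, y i ^ β i)]
  simp

/-- The multiples by monomials of the elements of `F` which are forms of degree `e`: the rows of
the Macaulay matrix. -/
def macaulayRows {ι A : Type} [CommSemiring A] (F : Set (MvPolynomial ι A)) (e : ℕ) :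
    Set (MvPolynomial ι A) :=
  {g | g.IsHomogeneous e ∧ ∃ f ∈ F, ∃ α, g = monomial α 1 * f}

/-- The resultant system of `F`: the maximal minors of all the Macaulay matrices. -/
def resultants {ι A : Type} [Fintype ι] [CommRing A] (F : Set (MvPolynomial ι A)) : Set A :=
  {s | ∃ (e : ℕ) (g : DegExp ι e → MvPolynomial ι A), (∀ r, g r ∈ macaulayRows F e) ∧
    s = Matrix.det (Matrix.of fun r c => coeff c.1 (g r))}

lemma exists_det_ne_zero_of_span_eq_top {ι K : Type} [Fintype ι] [DecidableEq ι] [Field K]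
    {W : Set (ι → K)} (hW : Submodule.span K W = ⊤) :
    ∃ g : ι → (ι → K), (∀ r, g r ∈ W) ∧ (Matrix.of g).det ≠ 0 := by
  obtain ⟨b, hbW, hspan, hli⟩ := exists_linearIndependent K W
  rw [hW] at hspan
  let B := Module.Basis.mk hli (by rw [Subtype.range_coe, hspan])
  have : Finite b := Module.Finite.finite_basis B
  have := Fintype.ofFinite b
  have hcard : Fintype.card ι = Fintype.card b := by
    rw [← Module.finrank_eq_card_basis B, Module.finrank_fintype_fun_eq_card]
  let e := Fintype.equivOfCardEq hcard
  refine ⟨fun r => (e r).1, fun r => hbW (e r).2, ?_⟩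
  have h := hli.comp e e.injective
  have : LinearIndependent K (Matrix.of fun r => ((e r).1 : ι → K)).row := h
  rw [Matrix.linearIndependent_rows_iff_isUnit, Matrix.isUnit_iff_isUnit_det] at this
  exact this.ne_zero

/-- An element of the ideal is a linear combination of monomial multiples of the generators. As the
generators are homogeneous, each multiple has one degree, and those of degree `e` are Macaulay rows.
-/
lemma coeff_mem_span_of_mem_ideal {ι A K : Type} [Fintype ι] [CommRing A] [Field K] (φ : A →+* K)
    {F : Set (MvPolynomial ι A)} (hF : ∀ f ∈ F, ∃ d, f.IsHomogeneous d) (e : ℕ)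
    {h : MvPolynomial ι K} (hh : h ∈ Ideal.span (map φ '' F)) :
    (fun c : DegExp ι e => coeff c.1 h) ∈ Submodule.span K
      ((fun g => fun c : DegExp ι e => coeff c.1 (map φ g)) '' macaulayRows F e) := by
  set W := Submodule.span K
      ((fun g => fun c : DegExp ι e => coeff c.1 (map φ g)) '' macaulayRows F e) with hW
  -- Quantifying over all monomial multiples lets the induction pass through multiplication by
  -- polynomials.
  have key : ∀ α : ι →₀ ℕ, (fun c : DegExp ι e => coeff c.1 (monomial α 1 * h)) ∈ W := by
    induction hh using Submodule.span_induction with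
    | mem x hx =>
      obtain ⟨f, hf, rfl⟩ := hx
      intro α
      obtain ⟨d, hd⟩ := hF f hf
      have hhom : (monomial α 1 * f).IsHomogeneous (α.degree + d) :=
        (isHomogeneous_monomial _ rfl).mul hd
      by_cases hed : α.degree + d = e
      · refine Submodule.subset_span ⟨monomial α 1 * f, ⟨hed ▸ hhom, f, hf, α, rfl⟩, ?_⟩
        simp
      · convert W.zero_mem with c
        have := (hhom.map φ).coeff_eq_zero (d := c.1) (by rw [c.2]; exact Ne.symm hed)
        simpa using this
    | zero => intro α; convert W.zero_mem with c; simp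
    | add x y _ _ hx hy =>
      intro α
      convert W.add_mem (hx α) (hy α) using 1
      ext c
      simp [mul_add]
    | smul a x _ hx =>
      intro α
      induction a using MvPolynomial.induction_on' with
      | monomial u r =>
        convert W.smul_mem r (hx (α + u)) using 1
        ext c
        have : monomial α 1 * (monomial u r • x) = C r * (monomial (α + u) 1 * x) := by
          rw [smul_eq_mul, ← mul_assoc, ← mul_assoc, monomial_mul, C_mul_monomial]; simp
        simp only [smul_eq_mul] at this
        simp only [this, coeff_C_mul, Pi.smul_apply, smul_eq_mul]
      | add p q hp hq =>
        convert W.add_mem hp hq using 1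
        ext c
        simp [add_mul, mul_add]
  simpa using key 0

/-- Elimination theory: the locus of the parameters for which a system of forms has a non-trivial
zero is defined by the resultant system. -/
theorem exists_zero_iff_resultants {ι A K : Type} [Fintype ι] [CommRing A] [Field K]
    [IsAlgClosed K] (φ : A →+* K)
    {F : Set (MvPolynomial ι A)} (hF : ∀ f ∈ F, ∃ d, f.IsHomogeneous d) :
    (∃ y : ι → K, y ≠ 0 ∧ ∀ f ∈ F, eval y (map φ f) = 0) ↔ ∀ s ∈ resultants F, φ s = 0 := by
  classical
  constructor
  · rintro ⟨y, hy, hyF⟩ s ⟨e, g, hg, rfl⟩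
    rw [RingHom.map_det, ← Matrix.exists_mulVec_eq_zero_iff]
    obtain ⟨i, hi⟩ := Function.ne_iff.1 hy
    -- The vector of monomials of degree `e` at `y` is a kernel vector; its entry at the e-th power
    -- of a nonzero coordinate is nonzero.
    refine ⟨fun c => ∏ i, y i ^ c.1 i, ?_, ?_⟩
    · refine Function.ne_iff.2 ⟨⟨Finsupp.single i e, by simp⟩, ?_⟩
      simp only [Pi.zero_apply] at hi ⊢
      rw [Finset.prod_eq_single i]
      · simpa using pow_ne_zero _ hi
      · intro j _ hj; simp [hj.symm]
      · simp
    · ext r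
      obtain ⟨hhom, f, hf, α, hgr⟩ := hg r
      have h0 : eval y (map φ (g r)) = 0 := by simp [hgr, hyF f hf]
      rw [eval_eq_sum_degExp (hhom.map φ)] at h0
      simpa [Matrix.mulVec, dotProduct, coeff_map] using h0
  · contrapose!
    intro hno
    set I : Ideal (MvPolynomial ι K) := Ideal.span (map φ '' F) with hI
    -- Nullstellensatz: the zero locus is contained in the origin, so every variable lies in the
    -- radical.
    have hrad : ∀ i, ∃ k, (X i : MvPolynomial ι K) ^ k ∈ I := by
      intro i
      have : (X i : MvPolynomial ι K) ∈ I.radical := by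
        rw [← vanishingIdeal_zeroLocus_eq_radical (K := K), mem_vanishingIdeal_iff]
        intro y hy
        by_contra hne
        obtain ⟨f, hf, hfy⟩ := hno y (by rintro rfl; simp at hne)
        apply hfy
        have := hy (map φ f) (Ideal.subset_span ⟨f, hf, rfl⟩)
        simpa [MvPolynomial.aeval_eq_eval] using this
      exact this
    choose k hk using hrad
    -- By pigeonhole, a monomial of this degree is divisible by some X_i^{k_i}; the `+ 1` also
    -- covers an empty set of variables.
    let e := ∑ i, k i + 1
    have hmem : ∀ c : DegExp ι e, (monomial c.1 1 : MvPolynomial ι K) ∈ I := by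
      intro c
      obtain ⟨i, hi⟩ : ∃ i, k i ≤ c.1 i := by
        by_contra! hlt
        have h1 := Finset.sum_le_sum fun i (_ : i ∈ Finset.univ) => (hlt i).le
        have h2 := c.2
        rw [Finsupp.degree_eq_sum] at h2
        omega
      have : (monomial c.1 1 : MvPolynomial ι K) =
          X i ^ k i * monomial (c.1 - Finsupp.single i (k i)) 1 := by
        rw [X_pow_eq_monomial, monomial_mul, mul_one]
        rw [add_tsub_cancel_of_le (Finsupp.single_le_iff.2 hi)]
      rw [this]
      exact I.mul_mem_right _ (hk i)
    have hspan : Submodule.span K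
        ((fun g => fun c : DegExp ι e => coeff c.1 (map φ g)) '' macaulayRows F e) = ⊤ := by
      rw [eq_top_iff, ← (Pi.basisFun K (DegExp ι e)).span_eq, Submodule.span_le]
      rintro _ ⟨c, rfl⟩
      have hc : Pi.basisFun K (DegExp ι e) c =
          fun c' => coeff c'.1 (monomial c.1 1 : MvPolynomial ι K) := by
        ext c'
        simp [Pi.single_apply, coeff_monomial, Subtype.ext_iff, eq_comm]
      rw [hc]
      exact coeff_mem_span_of_mem_ideal φ hF e (hmem c)
    obtain ⟨g, hg, hdet⟩ := exists_det_ne_zero_of_span_eq_top hspan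
    choose g' hg' hgg' using hg
    refine ⟨_, ⟨e, g', hg', rfl⟩, ?_⟩
    rw [RingHom.map_det]
    convert hdet using 2
    ext r c
    simp [← hgg' r, coeff_map]

end Cremona

/-! ### Invariants of bounded degree through Plücker coordinates. -/

namespace Cremona

open MvPolynomial

/-- There is a non-constant quotient of two forms of degree `m` which is invariant under each of
the transformations `I k`. -/
def HasCommonInvariant {n ν : ℕ} (I : Fin ν → Forms n ℂ) (m : ℕ) : Prop :=
  ∃ P Q : MvPolynomial (Fin (n + 1)) ℂ, P.IsHomogeneous m ∧ Q.IsHomogeneous m ∧ Q ≠ 0 ∧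
    (¬ ∃ c : ℂ, P = C c * Q) ∧ ∀ k, bind₁ (I k) P * Q = bind₁ (I k) Q * P

lemma eq_sum_degExp {ι A : Type} [Finite ι] [CommSemiring A] {e : ℕ}
    {p : MvPolynomial ι A} (hp : p.IsHomogeneous e) :
    p = ∑ β : DegExp ι e, C (coeff β.1 p) * monomial β.1 1 := by
  conv_lhs => rw [p.as_sum]
  rw [sum_support_eq_sum_degExp hp (fun β a => monomial β a) (by simp)]
  simp [C_mul_monomial]

lemma isHomogeneous_sum_degExp {ι A : Type} [Finite ι] [CommSemiring A] {e : ℕ}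
    (p : DegExp ι e → A) :
    (∑ β : DegExp ι e, C (p β) * monomial β.1 1).IsHomogeneous e := by
  refine IsHomogeneous.sum _ _ _ fun β _ => ?_
  rw [C_mul_monomial]
  exact isHomogeneous_monomial _ β.2

lemma coeff_sum_degExp {ι A : Type} [Finite ι] [CommSemiring A] {e : ℕ}
    (p : DegExp ι e → A) (a : DegExp ι e) :
    coeff a.1 (∑ β : DegExp ι e, C (p β) * monomial β.1 1) = p a := by
  classical
  simp only [coeff_sum, coeff_C_mul, coeff_monomial, ← Subtype.ext_iff]
  simp

/-- The bilinear form which measures the failure of the invariance of `P / Q` under `F`. -/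
lemma bind_mul_sub_bind_mul {ι A : Type} [Finite ι] [CommRing A] {e : ℕ}
    (F : ι → MvPolynomial ι A) (p q : DegExp ι e → A) :
    bind₁ F (∑ β : DegExp ι e, C (p β) * monomial β.1 1) *
        (∑ β : DegExp ι e, C (q β) * monomial β.1 1) -
      bind₁ F (∑ β : DegExp ι e, C (q β) * monomial β.1 1) *
        (∑ β : DegExp ι e, C (p β) * monomial β.1 1) =
      ∑ a : DegExp ι e, ∑ b : DegExp ι e, C (p a * q b - q a * p b) *
        (bind₁ F (monomial a.1 1) * monomial b.1 1) := by
  simp only [map_sum, map_mul, bind₁_C_right, Finset.sum_mul_sum, ← Finset.sum_sub_distrib, map_sub]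
  refine Finset.sum_congr rfl fun a _ => Finset.sum_congr rfl fun b _ => ?_
  ring

/-- The quadratic relations between the minors of a matrix with two rows. -/
noncomputable def plueckerRelations (E A : Type) [CommRing A] : Set (MvPolynomial (E × E) A) :=
  Set.range (fun a => X (a, a)) ∪ Set.range (fun a : E × E => X (a.1, a.2) + X (a.2, a.1)) ∪
    Set.range (fun a : (E × E) × (E × E) => X (a.1.1, a.1.2) * X (a.2.1, a.2.2) -
      X (a.1.1, a.2.1) * X (a.1.2, a.2.2) + X (a.1.1, a.2.2) * X (a.1.2, a.2.1))

/-- The system of linear equations for the minors of the coefficients of `P` and `Q` which says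
that `P / Q` is invariant under the maps `F k`. -/
noncomputable def invarianceEquations {n ν : ℕ} {A : Type} [CommRing A] (F : Fin ν → Forms n A)
    (m : ℕ) : Set (MvPolynomial (DegExp (Fin (n + 1)) m × DegExp (Fin (n + 1)) m) A) :=
  Set.range fun kγ : Fin ν × (Fin (n + 1) →₀ ℕ) =>
    ∑ a, ∑ b, C (coeff kγ.2 (bind₁ (F kγ.1) (monomial a.1 1) * monomial b.1 1)) * X (a, b)

lemma eval_invarianceEquations {n ν : ℕ} {A : Type} [CommRing A] (φ : A →+* ℂ)
    (F : Fin ν → Forms n A) (m : ℕ)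
    (ω : DegExp (Fin (n + 1)) m × DegExp (Fin (n + 1)) m → ℂ) :
    (∀ f ∈ invarianceEquations F m, eval ω (map φ f) = 0) ↔
      ∀ k, ∑ a, ∑ b, C (ω (a, b)) *
        (bind₁ (fun i => map φ (F k i)) (monomial a.1 1) * monomial b.1 1) = 0 := by
  simp only [invarianceEquations, Set.forall_mem_range, Prod.forall]
  refine forall_congr' fun k => ?_
  rw [MvPolynomial.ext_iff]
  refine forall_congr' fun γ => ?_
  have : ∀ a b : DegExp (Fin (n + 1)) m,
      bind₁ (fun i => map φ (F k i)) (monomial a.1 1) * monomial b.1 1 =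
        map φ (bind₁ (F k) (monomial a.1 1) * monomial b.1 1) := by
    intro a b
    simp [map_bind₁]
  simp only [this, coeff_sum, coeff_C_mul, coeff_map, coeff_zero, mul_comm (ω _)]
  simp only [map_sum, map_mul, map_C, eval_C, map_X, eval_X]

/-- The existence of a common invariant is a closed condition on the parameters of a family. -/
theorem hasCommonInvariant_iff_resultants {n ν : ℕ} {A : Type} [CommRing A] (φ : A →+* ℂ)
    (F : Fin ν → Forms n A) (m : ℕ) :
    HasCommonInvariant (fun k i => map φ (F k i)) m ↔
      ∀ s ∈ resultants (plueckerRelations (DegExp (Fin (n + 1)) m) A ∪ invarianceEquations F m),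
        φ s = 0 := by
  rw [← exists_zero_iff_resultants φ]
  · constructor
    · rintro ⟨P, Q, hP, hQ, hQ0, hPQ, hinv⟩
      -- The Plücker coordinates of the pencil; if all vanished, P would be a multiple of Q.
      refine ⟨fun ab => coeff ab.1.1 P * coeff ab.2.1 Q - coeff ab.1.1 Q * coeff ab.2.1 P,
        ?_, ?_⟩
      · intro h0
        have h1 : ∀ a b : DegExp (Fin (n + 1)) m,
            coeff a.1 P * coeff b.1 Q = coeff a.1 Q * coeff b.1 P := fun a b =>
          sub_eq_zero.1 (congrFun h0 (a, b))
        obtain ⟨b, hb⟩ := ne_zero_iff.1 hQ0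
        have hbm : b.degree = m := by
          by_contra h
          exact hb (hQ.coeff_eq_zero h)
        refine hPQ ⟨coeff b P / coeff b Q, ?_⟩
        ext a
        rw [coeff_C_mul]
        by_cases ha : a.degree = m
        · have := h1 ⟨a, ha⟩ ⟨b, hbm⟩
          field_simp
          linear_combination this
        · simp [hP.coeff_eq_zero ha, hQ.coeff_eq_zero ha]
      · rintro f (((⟨a, rfl⟩ | ⟨a, rfl⟩) | ⟨a, rfl⟩) | hf)
        · simp; ring
        · simp; ring
        · simp; ring
        · revert f hf
          rw [eval_invarianceEquations]
          intro k
          have h := bind_mul_sub_bind_mul (fun i => map φ (F k i))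
            (fun a : DegExp (Fin (n + 1)) m => coeff a.1 P) (fun a => coeff a.1 Q)
          rw [← eq_sum_degExp hP, ← eq_sum_degExp hQ, sub_eq_zero.2 (hinv k)] at h
          exact h.symm
    · rintro ⟨ω, hω, hF⟩
      obtain ⟨⟨i, j⟩, hij⟩ := Function.ne_iff.1 hω
      simp only [Pi.zero_apply] at hij
      have hdiag : ∀ a, ω (a, a) = 0 := fun a => by
        simpa using hF (X (a, a)) (Or.inl (Or.inl (Or.inl ⟨a, rfl⟩)))
      have hanti : ω (j, i) = - ω (i, j) := by
        have := hF (X (i, j) + X (j, i)) (Or.inl (Or.inl (Or.inr ⟨(i, j), rfl⟩)))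
        simp only [map_add, map_X, eval_X] at this
        linear_combination this
      have hpl : ∀ a b, ω (i, a) * ω (j, b) - ω (j, a) * ω (i, b) = ω (i, j) * ω (a, b) := by
        intro a b
        have := hF _ (Or.inl (Or.inr ⟨((i, j), (a, b)), rfl⟩))
        simp only [map_add, map_sub, map_mul, map_X, eval_X] at this
        linear_combination -this
      -- Rows i and j of ω recover the pencil: by `hpl` their minors are ω(i,j) ω. The coefficients
      -- at i and j, with ω(i,j) ≠ 0 and a vanishing diagonal, show Q ≠ 0 and P/Q non-constant.
      refine ⟨∑ β, C (ω (i, β)) * monomial β.1 1, ∑ β, C (ω (j, β)) * monomial β.1 1,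
        isHomogeneous_sum_degExp _, isHomogeneous_sum_degExp _, ?_, ?_, ?_⟩
      · intro h0
        have := congrArg (coeff i.1) h0
        rw [coeff_sum_degExp, hanti] at this
        simp [hij] at this
      · rintro ⟨c, hc⟩
        have h1 := congrArg (coeff j.1) hc
        rw [coeff_C_mul, coeff_sum_degExp, coeff_sum_degExp, hdiag, mul_zero] at h1
        exact hij h1
      · intro k
        rw [← sub_eq_zero, bind_mul_sub_bind_mul (F := fun i => map φ (F k i))]
        have h2 := (eval_invarianceEquations φ F m ω).1 (fun f hf => hF f (Or.inr hf)) k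
        simp only [hpl, C_mul, mul_assoc, ← Finset.mul_sum]
        rw [h2, mul_zero]
  · rintro f (((⟨a, rfl⟩ | ⟨a, rfl⟩) | ⟨a, rfl⟩) | ⟨kγ, rfl⟩)
    · exact ⟨1, isHomogeneous_X _ _⟩
    · exact ⟨1, (isHomogeneous_X _ _).add (isHomogeneous_X _ _)⟩
    · exact ⟨2, (((isHomogeneous_X _ _).mul (isHomogeneous_X _ _)).sub
        ((isHomogeneous_X _ _).mul (isHomogeneous_X _ _))).add
        ((isHomogeneous_X _ _).mul (isHomogeneous_X _ _))⟩
    · exact ⟨1, IsHomogeneous.sum _ _ _ fun a _ => IsHomogeneous.sum _ _ _ fun b _ =>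
        (isHomogeneous_X _ _).C_mul _⟩

end Cremona

/-! ### Composition of forms, dominance, and closedness for involutions. -/

namespace Cremona

open MvPolynomial

lemma bind_comp {n : ℕ} (F G : Forms n ℂ) (p : MvPolynomial (Fin (n + 1)) ℂ) :
    bind₁ (comp F G) p = bind₁ G (bind₁ F p) := (bind₁_bind₁ _ _ _).symm

lemma comp_assoc {n : ℕ} (F G K : Forms n ℂ) : comp (comp F G) K = comp F (comp G K) := by
  funext i
  exact (bind_comp G K (F i)).symm

lemma comp_ident {n : ℕ} (F : Forms n ℂ) : comp F (ident n) = F := by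
  funext i
  exact aeval_X_left_apply _

lemma ident_comp {n : ℕ} (F : Forms n ℂ) : comp (ident n) F = F := by
  funext i
  exact bind₁_X_right _ _

lemma homogeneous_bind {n a m : ℕ} {G : Forms n ℂ} (hG : ∀ i, (G i).IsHomogeneous a)
    {Q : MvPolynomial (Fin (n + 1)) ℂ} (hQ : Q.IsHomogeneous m) :
    (bind₁ G Q).IsHomogeneous (m * a) := by
  rw [mul_comm]
  exact hQ.aeval G hG

lemma homogeneous_comp {n a b : ℕ} {F G : Forms n ℂ} (hF : ∀ i, (F i).IsHomogeneous b)
    (hG : ∀ i, (G i).IsHomogeneous a) (i) : (comp F G i).IsHomogeneous (b * a) :=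
  homogeneous_bind hG (hF i)

lemma aeval_mul_homogeneous {n m : ℕ} {A : Type*} [CommRing A] [Algebra ℂ A]
    {Q : MvPolynomial (Fin (n + 1)) ℂ} (hQ : Q.IsHomogeneous m) (c : A) (z : Fin (n + 1) → A) :
    aeval (fun i => c * z i) Q = c ^ m * aeval z Q := by
  rw [aeval_def, aeval_def, eval₂_eq', eval₂_eq', Finset.mul_sum]
  refine Finset.sum_congr rfl fun β hβ => ?_
  have : β.degree = m := by
    by_contra h
    exact (mem_support_iff.1 hβ) (hQ.coeff_eq_zero h)
  simp only [mul_pow, Finset.prod_mul_distrib, Finset.prod_pow_eq_pow_sum]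
  rw [← Finsupp.degree_eq_sum, this]
  ring

lemma bind_mul_homogeneous {n m : ℕ} {Q : MvPolynomial (Fin (n + 1)) ℂ} (hQ : Q.IsHomogeneous m)
    (φ : MvPolynomial (Fin (n + 1)) ℂ) (G : Forms n ℂ) :
    bind₁ (fun i => φ * G i) Q = φ ^ m * bind₁ G Q :=
  aeval_mul_homogeneous hQ φ G

/-- The image of the rational map is Zariski dense. -/
def Dominant {n : ℕ} (G : Forms n ℂ) : Prop :=
  ∀ (m : ℕ) (Q : MvPolynomial (Fin (n + 1)) ℂ), Q.IsHomogeneous m → Q ≠ 0 → bind₁ G Q ≠ 0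

lemma dominant_ident (n : ℕ) : Dominant (ident n) := fun m Q _ h => by
  have : bind₁ (ident n) Q = Q := aeval_X_left_apply _
  rwa [this]

lemma Dominant.comp {n a : ℕ} {F G : Forms n ℂ} (hF : Dominant F)
    (hFa : ∀ i, (F i).IsHomogeneous a) (hG : Dominant G) : Dominant (comp F G) := by
  intro m Q hQ h0
  rw [bind_comp]
  exact hG _ _ (homogeneous_bind hFa hQ) (hF m Q hQ h0)

/-- From F_i X_j = F_j X_i with j ≠ i, primality of X_i gives X_i ∣ F_i, and the quotients agree; a
second coordinate is needed. The explicit factor φ is what later compositions keep track of. -/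
lemma sameMap_ident_iff {n : ℕ} (hn : 1 ≤ n) (F : Forms n ℂ) :
    SameMap F (ident n) ↔ ∃ φ, φ ≠ 0 ∧ ∀ i, F i = φ * X i := by
  constructor
  · rintro ⟨hF, -, h⟩
    simp only [ident] at h
    have hdvd : ∀ i, X i ∣ F i := by
      intro i
      obtain ⟨j, hj⟩ : ∃ j : Fin (n + 1), j ≠ i := by
        have : Nontrivial (Fin (n + 1)) := Fin.nontrivial_iff_two_le.2 (by omega)
        exact exists_ne i
      have h1 : X i ∣ F i * X j := ⟨F j, by rw [h i j, mul_comm]⟩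
      refine ((X_prime).dvd_or_dvd h1).resolve_right fun h2 => hj ?_
      rw [X_dvd_X] at h2
      simpa using h2.symm
    choose φ hφ using hdvd
    have hφ0 : ∀ i, φ i = φ 0 := by
      intro i
      have h1 := h i 0
      rw [hφ i, hφ 0] at h1
      have : (X i * X 0 : MvPolynomial (Fin (n + 1)) ℂ) ≠ 0 :=
        mul_ne_zero (X_ne_zero _) (X_ne_zero _)
      exact mul_left_cancel₀ this (by linear_combination h1)
    refine ⟨φ 0, ?_, fun i => by rw [hφ i, hφ0 i, mul_comm]⟩
    intro h0
    exact hF (funext fun i => by rw [hφ i, hφ0 i, h0, mul_zero]; rfl)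
  · rintro ⟨φ, hφ, h⟩
    refine ⟨?_, ?_, fun i j => by simp only [h, ident]; ring⟩
    · intro h0
      have := congrFun h0 0
      rw [h] at this
      exact mul_ne_zero hφ (X_ne_zero _) this
    · intro h0
      exact X_ne_zero (R := ℂ) (0 : Fin (n + 1)) (congrFun h0 0)

/-- If a tuple of forms is `φ x`, then `φ` stays nonzero after a dominant substitution. -/
lemma Dominant.bind_factor_ne_zero {n d : ℕ} {F K : Forms n ℂ}
    {φ : MvPolynomial (Fin (n + 1)) ℂ} (hK : Dominant K) (hF : (F 0).IsHomogeneous d)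
    (h : ∀ i, F i = φ * X i) (hφ : φ ≠ 0) : bind₁ K φ ≠ 0 := by
  intro h0
  refine hK d (F 0) hF ?_ ?_
  · rw [h]
    exact mul_ne_zero hφ (X_ne_zero _)
  · rw [h, map_mul, h0, zero_mul]

/-- Substituting H into Q(G) gives φ^m Q, which is nonzero, so Q(G) cannot vanish. -/
lemma dominant_of_comp {n : ℕ} {G H : Forms n ℂ} {φ : MvPolynomial (Fin (n + 1)) ℂ} (hφ : φ ≠ 0)
    (h : ∀ i, comp G H i = φ * X i) : Dominant G := by
  intro m Q hQ h0 h1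
  have h2 : bind₁ (comp G H) Q = φ ^ m * Q := by
    rw [show comp G H = fun i => φ * ident n i from funext h, bind_mul_homogeneous hQ]
    congr 1
    exact aeval_X_left_apply _
  rw [bind_comp, h1, map_zero] at h2
  exact mul_ne_zero (pow_ne_zero _ hφ) h0 h2.symm

lemma comp_mul {n a : ℕ} {F : Forms n ℂ} (hF : ∀ i, (F i).IsHomogeneous a)
    (φ : MvPolynomial (Fin (n + 1)) ℂ) (G : Forms n ℂ) :
    comp F (fun i => φ * G i) = fun i => φ ^ a * comp F G i := by
  funext i
  simp only [comp, bind_mul_homogeneous (hF i)]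

lemma mul_comp {n : ℕ} (φ : MvPolynomial (Fin (n + 1)) ℂ) (F G : Forms n ℂ) :
    comp (fun i => φ * F i) G = fun i => bind₁ G φ * comp F G i := by
  funext i
  simp only [comp, map_mul]

/-- `G` and `H` are forms of degrees `a` and `b` which describe mutually inverse birational
transformations. -/
structure InversePair {n : ℕ} (a b : ℕ) (G H : Forms n ℂ) : Prop where
  homogeneous : ∀ i, (G i).IsHomogeneous a
  homogeneous_inv : ∀ i, (H i).IsHomogeneous b
  left_inv : SameMap (comp H G) (ident n)
  right_inv : SameMap (comp G H) (ident n)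

lemma InversePair.dominant {n a b : ℕ} (hn : 1 ≤ n) {G H : Forms n ℂ} (h : InversePair a b G H) :
    Dominant G := by
  obtain ⟨φ, hφ, h1⟩ := (sameMap_ident_iff hn _).1 h.right_inv
  exact dominant_of_comp hφ h1

lemma InversePair.symm {n a b : ℕ} {G H : Forms n ℂ} (h : InversePair a b G H) :
    InversePair b a H G := ⟨h.2, h.1, h.4, h.3⟩

/-- The factor of H∘G is pulled back by G' and raised to the degree of H'; dominance of G' keeps it
nonzero. -/
lemma sameMap_comp_comp {n a b a' b' : ℕ} (hn : 1 ≤ n) {G H G' H' : Forms n ℂ}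
    (h : InversePair a b G H) (h' : InversePair a' b' G' H') :
    SameMap (comp (comp H' H) (comp G G')) (ident n) := by
  obtain ⟨φ, hφ, h1⟩ := (sameMap_ident_iff hn _).1 h.left_inv
  obtain ⟨φ', hφ', h1'⟩ := (sameMap_ident_iff hn _).1 h'.left_inv
  rw [sameMap_ident_iff hn]
  have e1 : comp (comp H' H) (comp G G') = comp H' (comp (comp H G) G') := by
    simp only [comp_assoc]
  have e2 : comp H G = fun i => φ * ident n i := funext h1
  refine ⟨bind₁ G' φ ^ b' * φ', mul_ne_zero (pow_ne_zero _ ?_) hφ', fun i => ?_⟩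
  · exact (h'.dominant hn).bind_factor_ne_zero
      (homogeneous_comp h.homogeneous_inv h.homogeneous 0) h1 hφ
  · rw [e1, e2, mul_comp, ident_comp, comp_mul h'.homogeneous_inv, mul_assoc, ← h1']

lemma InversePair.comp {n a b a' b' : ℕ} (hn : 1 ≤ n) {G H G' H' : Forms n ℂ}
    (h : InversePair a b G H) (h' : InversePair a' b' G' H') :
    InversePair (a * a') (b' * b) (Cremona.comp G G') (Cremona.comp H' H) :=
  ⟨homogeneous_comp h.1 h'.1, homogeneous_comp h'.2 h.2, sameMap_comp_comp hn h h',
    sameMap_comp_comp hn h'.symm h.symm⟩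

lemma IsInvolution.inversePair {n d : ℕ} {F : Forms n ℂ} (h : IsInvolution d F) :
    InversePair d d F F := ⟨h.1, h.1, h.2, h.2⟩

lemma IsInvolution.ne_zero {n d : ℕ} {F : Forms n ℂ} (hn : 1 ≤ n) (h : IsInvolution d F) (i) :
    F i ≠ 0 := by
  intro h0
  refine h.inversePair.dominant hn 1 (X i) (isHomogeneous_X _ _) (X_ne_zero _) ?_
  rw [bind₁_X_right, h0]

/-- Conjugation turns involutions into involutions. -/
theorem IsInvolution.conj {n a b d : ℕ} (hn : 1 ≤ n) {F G H : Forms n ℂ} (hF : IsInvolution d F)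
    (h : InversePair a b G H) : IsInvolution (b * (d * a)) (comp H (comp F G)) := by
  have hpair := h.symm.comp hn (hF.inversePair.comp hn h)
  refine ⟨hpair.homogeneous, ?_, ?_⟩
  · have := hpair.right_inv
    simp only [comp_assoc] at this ⊢
    exact this
  · intro hsame
    obtain ⟨χ, hχ, h1⟩ := (sameMap_ident_iff hn _).1 hsame
    obtain ⟨ψ, hψ, h2⟩ := (sameMap_ident_iff hn _).1 h.right_inv
    have e1 : comp H (comp F G) = fun i => χ * ident n i := funext h1
    have e2 : comp G H = fun i => ψ * ident n i := funext h2
    -- G(HFG)H is computed twice, here from HFG ∼ id and in `e4` from GH ∼ id; comparison yields F ∼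
    -- id.
    have e3 : comp (comp G (comp H (comp F G))) H =
        fun i => (bind₁ H χ ^ a * ψ) * X i := by
      rw [e1, comp_mul h.homogeneous, comp_ident, mul_comp, e2]
      funext i
      simp only [map_pow, ident, mul_assoc]
    have e4 : comp (comp G (comp H (comp F G))) H =
        fun i => (bind₁ (comp F (comp G H)) ψ * ψ ^ d) * F i := by
      have : comp (comp G (comp H (comp F G))) H = comp (comp G H) (comp F (comp G H)) := by
        simp only [comp_assoc]
      rw [this, e2, mul_comp, ident_comp, comp_mul hF.homogeneous, comp_ident]
      funext i
      rw [mul_assoc]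
    have hdom : Dominant (comp F (comp G H)) := (hF.inversePair.dominant hn).comp hF.homogeneous
      ((h.dominant hn).comp h.homogeneous (h.symm.dominant hn))
    have hne : bind₁ (comp F (comp G H)) ψ * ψ ^ d ≠ 0 := mul_ne_zero
      (hdom.bind_factor_ne_zero (homogeneous_comp h.homogeneous h.homogeneous_inv 0) h2 hψ)
      (pow_ne_zero _ hψ)
    refine hF.nontrivial ⟨fun h0 => hF.ne_zero hn 0 (congrFun h0 0), ?_, fun i j => ?_⟩
    · exact fun h0 => X_ne_zero (R := ℂ) (0 : Fin (n + 1)) (congrFun h0 0)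
    · have hi := congrFun (e4.symm.trans e3)
      apply mul_left_cancel₀ hne
      simp only [ident]
      linear_combination X j * hi i - X i * hi j

lemma word_dominant {n ν : ℕ} (hn : 1 ≤ n) {d : Fin ν → ℕ} {I : Fin ν → Forms n ℂ}
    (hI : ∀ k, IsInvolution (d k) (I k)) (w : List (Fin ν)) : Dominant (word I w) := by
  induction w with
  | nil => exact dominant_ident n
  | cons k w ih => exact ((hI k).inversePair.dominant hn).comp (hI k).homogeneous ih

/-- For involutions, invariance under the generators suffices. -/
theorem hasNontrivialInvariant_iff {n ν : ℕ} (hn : 1 ≤ n) {d : Fin ν → ℕ} {I : Fin ν → Forms n ℂ}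
    (hI : ∀ k, IsInvolution (d k) (I k)) (m : ℕ) :
    HasNontrivialInvariant I m ↔ HasCommonInvariant I m := by
  refine exists_congr fun P => exists_congr fun Q => and_congr_right fun _ =>
    and_congr_right fun hQ => and_congr_right fun hQ0 => and_congr_right fun _ => ?_
  constructor
  · intro h k
    have := (h [k]).2
    rwa [word, word, comp_ident] at this
  · intro h w
    refine ⟨word_dominant hn hI w _ _ hQ hQ0, ?_⟩
    induction w with
    | nil =>
      have : ∀ p, bind₁ (word I []) p = p := fun p => aeval_X_left_apply p
      rw [this, this, mul_comm]
    | cons k w ih =>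
      rw [word, bind_comp, bind_comp]
      have h1 := congrArg (bind₁ (word I w)) (h k)
      rw [map_mul, map_mul] at h1
      apply mul_left_cancel₀ (word_dominant hn hI w _ _ hQ hQ0)
      linear_combination Q * h1 + bind₁ (word I w) (bind₁ (I k) Q) * ih

/-- P and Q have the same degree, so both sides acquire the factor c^m. This allows denominators to
be cleared in families. -/
lemma HasCommonInvariant.of_mul {n ν : ℕ} {I : Fin ν → Forms n ℂ} (c : Fin ν → ℂ) {m : ℕ}
    (h : HasCommonInvariant I m) : HasCommonInvariant (fun k i => C (c k) * I k i) m := by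
  obtain ⟨P, Q, hP, hQ, hQ0, hPQ, hinv⟩ := h
  refine ⟨P, Q, hP, hQ, hQ0, hPQ, fun k => ?_⟩
  rw [bind_mul_homogeneous hP, bind_mul_homogeneous hQ, mul_assoc, mul_assoc, hinv k]

/-- The tuple whose coefficients are variables. -/
noncomputable def genericForms (n ν : ℕ) (d : Fin ν → ℕ) :
    Fin ν → Forms n (MvPolynomial (Fin ν × Fin (n + 1) × (Fin (n + 1) →₀ ℕ)) ℂ) :=
  fun k i => ∑ β : DegExp (Fin (n + 1)) (d k), C (X (k, i, β.1)) * monomial β.1 1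

lemma map_genericForms {n ν : ℕ} {d : Fin ν → ℕ} {I : Fin ν → Forms n ℂ}
    (hI : ∀ k i, (I k i).IsHomogeneous (d k)) :
    (fun k i => map (eval (coeffVector I)) (genericForms n ν d k i)) = I := by
  funext k i
  conv_rhs => rw [eq_sum_degExp (hI k i)]
  simp [genericForms, coeffVector]

/-- Having a non-trivial invariant of bounded degree is a closed condition. -/
theorem isZariskiClosed_hasNontrivialInvariant {n : ℕ} (ν : ℕ) (hn : 1 ≤ n) (m : ℕ) :
    IsZariskiClosed (fun I : Fin ν → Forms n ℂ => HasNontrivialInvariant I m) := by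
  intro d
  refine ⟨resultants (plueckerRelations (DegExp (Fin (n + 1)) m) _ ∪
    invarianceEquations (genericForms n ν d) m), fun I hI => ?_⟩
  have h := hasCommonInvariant_iff_resultants (eval (coeffVector I)) (genericForms n ν d) m
  rw [map_genericForms fun k => (hI k).homogeneous] at h
  exact (hasNontrivialInvariant_iff hn hI m).trans h

end Cremona

/-! ### Leading monomials and independent multipliers. -/

namespace Cremona

open MvPolynomial

section LeadingMonomials

variable {n : ℕ} (mo : MonomialOrder (Fin (n + 1))) {F : Forms n ℂ} {γ : Fin (n + 1) →₀ ℕ}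
  {l : Fin (n + 1) → ℂ}

lemma prod_pow_ne_zero (hl : ∀ i, l i ≠ 0) (α : Fin (n + 1) →₀ ℕ) : ∏ i, l i ^ α i ≠ 0 :=
  Finset.prod_ne_zero_iff.2 fun i _ => pow_ne_zero _ (hl i)

lemma degree_leadingCoeff_prod_pow (hl : ∀ i, l i ≠ 0)
    (hdeg : ∀ i, mo.degree (F i) = γ + Finsupp.single i 1)
    (hlc : ∀ i, mo.leadingCoeff (F i) = l i) (α : Fin (n + 1) →₀ ℕ) :
    mo.degree (∏ i, F i ^ α i) = α.degree • γ + α ∧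
      mo.leadingCoeff (∏ i, F i ^ α i) = ∏ i, l i ^ α i := by
  have hF : ∀ i, F i ≠ 0 := fun i h => hl i (by rw [← hlc i, h, mo.leadingCoeff_zero])
  have hdeg' : mo.degree (∏ i, F i ^ α i) = α.degree • γ + α := by
    rw [mo.degree_prod fun i _ => pow_ne_zero _ (hF i)]
    simp only [mo.degree_pow, hdeg, smul_add, Finset.sum_add_distrib, ← Finset.sum_smul]
    rw [← Finsupp.degree_eq_sum]
    congr 1
    ext j
    simp
  refine ⟨hdeg', ?_⟩
  rw [mo.leadingCoeff_prod_of_regular fun i _ => ?_]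
  · simp only [mo.leadingCoeff_pow, hlc]
  · exact IsRegular.of_ne_zero (by rw [mo.leadingCoeff_pow, hlc]; exact pow_ne_zero _ (hl i))

/-- All exponents β of P have degree m, so substitution turns each into the leading exponent mγ + β:
a common translation preserves the order, and nothing cancels the top term. -/
lemma degree_leadingCoeff_bind (hl : ∀ i, l i ≠ 0)
    (hdeg : ∀ i, mo.degree (F i) = γ + Finsupp.single i 1)
    (hlc : ∀ i, mo.leadingCoeff (F i) = l i) {m : ℕ} {P : MvPolynomial (Fin (n + 1)) ℂ}
    (hP : P.IsHomogeneous m) (hP0 : P ≠ 0) :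
    mo.degree (bind₁ F P) = m • γ + mo.degree P ∧
      mo.leadingCoeff (bind₁ F P) = mo.leadingCoeff P * ∏ i, l i ^ mo.degree P i := by
  have hdegm : ∀ β ∈ P.support, β.degree = m := by
    intro β hβ
    by_contra h
    exact (mem_support_iff.1 hβ) (hP.coeff_eq_zero h)
  have hsum : bind₁ F P = ∑ β ∈ P.support, C (coeff β P) * ∏ i, F i ^ β i := by
    conv_lhs => rw [bind₁, aeval_def, eval₂_eq']
    rfl
  have hterm : ∀ β ∈ P.support,
      mo.degree (C (coeff β P) * ∏ i, F i ^ β i) = m • γ + β := by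
    intro β hβ
    rw [← smul_eq_C_mul, mo.degree_smul_of_isRegular
      (IsRegular.of_ne_zero (mem_support_iff.1 hβ)),
      (degree_leadingCoeff_prod_pow mo hl hdeg hlc β).1, hdegm β hβ]
  have hmem := mo.degree_mem_support hP0
  have hcoeff : coeff (m • γ + mo.degree P) (bind₁ F P) =
      mo.leadingCoeff P * ∏ i, l i ^ mo.degree P i := by
    rw [hsum, coeff_sum, Finset.sum_eq_single (mo.degree P)]
    · obtain ⟨h1, h2⟩ := degree_leadingCoeff_prod_pow mo hl hdeg hlc (mo.degree P)
      rw [coeff_C_mul, ← h2, MonomialOrder.leadingCoeff, MonomialOrder.leadingCoeff, h1,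
        hdegm _ hmem]
    · intro β hβ hne
      apply mo.coeff_eq_zero_of_lt
      rw [hterm β hβ, map_add, map_add]
      refine add_lt_add_right ?_ _
      exact lt_of_le_of_ne (mo.le_degree hβ) fun h => hne (mo.toSyn.injective h)
    · exact fun h => absurd hmem h
  have hne : coeff (m • γ + mo.degree P) (bind₁ F P) ≠ 0 := by
    rw [hcoeff]
    exact mul_ne_zero (mo.leadingCoeff_ne_zero_iff.2 hP0) (prod_pow_ne_zero hl _)
  have hdegree : mo.degree (bind₁ F P) = m • γ + mo.degree P := by
    apply mo.toSyn.injective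
    refine le_antisymm ?_ (mo.le_degree (mem_support_iff.2 hne))
    conv_lhs => rw [hsum]
    refine mo.degree_sum_le.trans (Finset.sup_le fun β hβ => ?_)
    rw [hterm β hβ, map_add, map_add]
    exact add_le_add_right (mo.le_degree hβ) _
  exact ⟨hdegree, by rw [← hcoeff, MonomialOrder.leadingCoeff, hdegree]⟩

/-- A transformation with a fixed flag and multiplicatively independent multipliers has no
non-constant invariants. -/
theorem eq_C_mul_of_invariant (hl : ∀ i, l i ≠ 0)
    (hdeg : ∀ i, mo.degree (F i) = γ + Finsupp.single i 1)
    (hlc : ∀ i, mo.leadingCoeff (F i) = l i)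
    (hind : ∀ α β : Fin (n + 1) →₀ ℕ, α.degree = β.degree →
      ∏ i, l i ^ α i = ∏ i, l i ^ β i → α = β)
    {m : ℕ} {P Q : MvPolynomial (Fin (n + 1)) ℂ}
    (hP : P.IsHomogeneous m) (hQ : Q.IsHomogeneous m) (hQ0 : Q ≠ 0)
    (hinv : bind₁ F P * Q = bind₁ F Q * P) : ∃ c : ℂ, P = C c * Q := by
  have hdegm : ∀ R : MvPolynomial (Fin (n + 1)) ℂ, R.IsHomogeneous m → R ≠ 0 →
      (mo.degree R).degree = m := by
    intro R hR hR0
    by_contra h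
    exact (mem_support_iff.1 (mo.degree_mem_support hR0)) (hR.coeff_eq_zero h)
  -- Needed for R = P − cQ, which satisfies the same equation against Q as P does.
  have key : ∀ R : MvPolynomial (Fin (n + 1)) ℂ, R.IsHomogeneous m → R ≠ 0 →
      bind₁ F R * Q = bind₁ F Q * R → mo.degree R = mo.degree Q := by
    intro R hR hR0 h
    have h1 := congrArg mo.leadingCoeff h
    rw [mo.leadingCoeff_mul, mo.leadingCoeff_mul, (degree_leadingCoeff_bind mo hl hdeg hlc hR hR0).2,
      (degree_leadingCoeff_bind mo hl hdeg hlc hQ hQ0).2] at h1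
    refine hind _ _ ((hdegm R hR hR0).trans (hdegm Q hQ hQ0).symm) ?_
    apply mul_left_cancel₀ (mul_ne_zero (mo.leadingCoeff_ne_zero_iff.2 hR0)
      (mo.leadingCoeff_ne_zero_iff.2 hQ0))
    linear_combination h1
  -- With this c the leading monomial of Q does not occur in P − cQ, although `key` would make it
  -- the leading one.
  refine ⟨coeff (mo.degree Q) P / mo.leadingCoeff Q, ?_⟩
  set c := coeff (mo.degree Q) P / mo.leadingCoeff Q with hc
  by_contra hne
  have hR0 : P - C c * Q ≠ 0 := sub_ne_zero.2 hne
  have hdegR := key _ (hP.sub (hQ.C_mul c)) hR0 (by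
    simp only [map_sub, map_mul, bind₁_C_right]
    linear_combination hinv)
  apply mo.leadingCoeff_ne_zero_iff.2 hR0
  rw [MonomialOrder.leadingCoeff, hdegR, coeff_sub, coeff_C_mul, hc]
  have := mo.leadingCoeff_ne_zero_iff.2 hQ0
  rw [MonomialOrder.leadingCoeff] at this ⊢
  field_simp
  ring

end LeadingMonomials

/-- Multiplicatively independent numbers: `1` and the prime numbers. -/
noncomputable def multiplier (i : ℕ) : ℂ := if i = 0 then 1 else (Nat.nth Nat.Prime i : ℂ)

lemma multiplier_ne_zero (i : ℕ) : multiplier i ≠ 0 := by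
  unfold multiplier
  split_ifs
  · exact one_ne_zero
  · exact Nat.cast_ne_zero.2 (Nat.prime_nth_prime i).ne_zero

/-- Equal degrees cancel the powers of c. Unique factorization then determines all exponents except
the one at 0, whose multiplier is 1; the degree gives that one. -/
lemma multiplier_independent {n : ℕ} {c : ℂ} (hc : c ≠ 0) {k : ℕ} (hk : k ≠ 0)
    (α β : Fin (n + 1) →₀ ℕ) (hdeg : α.degree = β.degree)
    (h : ∏ i : Fin (n + 1), (c * multiplier i ^ k) ^ α i =
      ∏ i : Fin (n + 1), (c * multiplier i ^ k) ^ β i) : α = β := by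
  have key : ∀ α : Fin (n + 1) →₀ ℕ, ∏ i : Fin (n + 1), (c * multiplier i ^ k) ^ α i = c ^ α.degree *
      ((∏ i : Fin n, Nat.nth Nat.Prime (i + 1) ^ (k * α i.succ) : ℕ) : ℂ) := by
    intro α
    simp only [mul_pow, Finset.prod_mul_distrib, Finset.prod_pow_eq_pow_sum,
      ← Finsupp.degree_eq_sum]
    rw [Fin.prod_univ_succ]
    simp [multiplier, pow_mul]
  have hfac : ∀ (α : Fin (n + 1) →₀ ℕ) (j : Fin n),
      (∏ i : Fin n, Nat.nth Nat.Prime (i + 1) ^ (k * α i.succ)).factorization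
        (Nat.nth Nat.Prime (j + 1)) = k * α j.succ := by
    intro α j
    rw [Nat.factorization_prod fun i _ => pow_ne_zero _ (Nat.prime_nth_prime _).ne_zero,
      Finsupp.finsetSum_apply, Finset.sum_eq_single j]
    · simp
    · intro i _ hij
      have : Nat.nth Nat.Prime (i + 1) ≠ Nat.nth Nat.Prime (j + 1) := fun h => hij (by
        have := Nat.nth_injective Nat.infinite_setOfPred_prime h
        ext; omega)
      simp [this]
    · simp
  rw [key, key, hdeg] at h
  have h1 := Nat.cast_injective (mul_left_cancel₀ (pow_ne_zero _ hc) h)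
  have hsucc : ∀ j : Fin n, α j.succ = β j.succ := by
    intro j
    have := hfac α j
    rw [h1, hfac β j] at this
    exact (Nat.eq_of_mul_eq_mul_left (Nat.pos_of_ne_zero hk) this).symm
  ext i
  refine Fin.cases ?_ hsucc i
  rw [Finsupp.degree_eq_sum, Finsupp.degree_eq_sum, Fin.sum_univ_succ, Fin.sum_univ_succ,
    Finset.sum_congr rfl fun j _ => hsucc j] at hdeg
  omega

end Cremona

/-! ### Collineated Hadamard inversions. -/

namespace Cremona

open MvPolynomial

/-- Composition of tuples of forms with coefficients in `A`. -/
noncomputable def compOver {n : ℕ} {A : Type} [CommSemiring A] (F G : Forms n A) : Forms n A :=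
  fun i => bind₁ G (F i)

/-- The linear forms `M x`. -/
noncomputable def linearOver {n : ℕ} {A : Type} [CommSemiring A]
    (M : Matrix (Fin (n + 1)) (Fin (n + 1)) A) : Forms n A :=
  fun i => ∑ j, C (M i j) * X j

lemma map_compOver {n : ℕ} {A : Type} [CommSemiring A] (φ : A →+* ℂ) (F G : Forms n A) :
    (fun i => map φ (compOver F G i)) = comp (fun i => map φ (F i)) (fun i => map φ (G i)) :=
  funext fun i => map_bind₁ φ G (F i)

lemma map_linearOver {n : ℕ} {A : Type} [CommSemiring A] (φ : A →+* ℂ)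
    (M : Matrix (Fin (n + 1)) (Fin (n + 1)) A) :
    (fun i => map φ (linearOver M i)) = linear (M.map φ) := by
  funext i
  simp [linearOver, linear]

lemma isHomogeneous_linearOver {n : ℕ} {A : Type} [CommSemiring A]
    (M : Matrix (Fin (n + 1)) (Fin (n + 1)) A) (i) : (linearOver M i).IsHomogeneous 1 :=
  IsHomogeneous.sum _ _ _ fun j _ => (isHomogeneous_X _ j).C_mul _

lemma isHomogeneous_linear {n : ℕ} (M : Matrix (Fin (n + 1)) (Fin (n + 1)) ℂ) (i) :
    (linear M i).IsHomogeneous 1 := isHomogeneous_linearOver M i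

lemma linear_one {n : ℕ} : linear (1 : Matrix (Fin (n + 1)) (Fin (n + 1)) ℂ) = ident n := by
  funext i
  simp [linear, ident, Matrix.one_apply]

lemma comp_linear {n : ℕ} (M N : Matrix (Fin (n + 1)) (Fin (n + 1)) ℂ) :
    comp (linear M) (linear N) = linear (M * N) := by
  funext i
  simp only [comp, linear, map_sum, map_mul, bind₁_C_right, bind₁_X_right, Matrix.mul_apply,
    Finset.mul_sum, Finset.sum_mul]
  rw [Finset.sum_comm]
  simp only [mul_assoc]

lemma linear_smul {n : ℕ} (c : ℂ) (M : Matrix (Fin (n + 1)) (Fin (n + 1)) ℂ) :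
    linear (c • M) = fun i => C c * linear M i := by
  funext i
  simp [linear, Finset.mul_sum, mul_assoc]

lemma sameMap_self_ident {n : ℕ} : SameMap (ident n) (ident n) := by
  have : ident n ≠ 0 := fun h0 => X_ne_zero (R := ℂ) (0 : Fin (n + 1)) (congrFun h0 0)
  exact ⟨this, this, fun i j => mul_comm _ _⟩

lemma inversePair_linear {n : ℕ} {M N : Matrix (Fin (n + 1)) (Fin (n + 1)) ℂ} (h : M * N = 1) :
    InversePair 1 1 (linear M) (linear N) := by
  refine ⟨isHomogeneous_linear M, isHomogeneous_linear N, ?_, ?_⟩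
  · rw [comp_linear, mul_eq_one_comm.1 h, linear_one]
    exact sameMap_self_ident
  · rw [comp_linear, h, linear_one]
    exact sameMap_self_ident

lemma X_mul_hadamard {n : ℕ} (i : Fin (n + 1)) : X i * hadamard n i = ∏ j, X j :=
  Finset.mul_prod_erase _ _ (Finset.mem_univ i)

/-- Substituting J into X_i J_i = ∏ X_j shows that J(J) is proportional to x. If J were the
identity, then X_o² = X_0², which fails where x_0 = 2 and x_o = 1. -/
theorem isInvolution_hadamard {n : ℕ} (hn : 1 ≤ n) : IsInvolution n (hadamard n) := by
  have hT : (∏ j, X j : MvPolynomial (Fin (n + 1)) ℂ) ≠ 0 :=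
    Finset.prod_ne_zero_iff.2 fun j _ => X_ne_zero _
  have hJ : ∀ i, hadamard n i ≠ 0 := fun i h => by
    have := X_mul_hadamard i
    rw [h, mul_zero] at this
    exact hT this.symm
  have key : ∀ i, (∏ j, X j) * comp (hadamard n) (hadamard n) i = (∏ j, hadamard n j) * X i := by
    intro i
    have h1 := congrArg (bind₁ (hadamard n)) (X_mul_hadamard i)
    rw [map_mul, bind₁_X_right, map_prod] at h1
    simp only [bind₁_X_right] at h1
    rw [← X_mul_hadamard i, ← h1, comp]
    ring
  refine ⟨fun i => ?_, ⟨?_, sameMap_self_ident.1, fun i j => ?_⟩, fun h => ?_⟩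
  · have := IsHomogeneous.prod (Finset.univ.erase i)
      (fun j => (X j : MvPolynomial (Fin (n + 1)) ℂ)) (fun _ => 1) fun j _ => isHomogeneous_X _ j
    simpa [hadamard] using this
  · intro h0
    have := key 0
    rw [h0, Pi.zero_apply, mul_zero] at this
    exact mul_ne_zero (Finset.prod_ne_zero_iff.2 fun j _ => hJ j) (X_ne_zero _) this.symm
  · apply mul_left_cancel₀ hT
    simp only [ident]
    linear_combination X j * key i - X i * key j
  · let o : Fin (n + 1) := ⟨1, by omega⟩
    have ho : o ≠ 0 := by simp [o, Fin.ext_iff]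
    have h1 := h.2.2 0 o
    have h2 := X_mul_hadamard (0 : Fin (n + 1))
    have h3 := X_mul_hadamard o
    have h4 : hadamard n 0 * (X o * X o) = hadamard n 0 * (X 0 * X 0) := by
      simp only [ident] at h1
      linear_combination X o * h1 + X 0 * h3 - X 0 * h2
    have h5 := congrArg (eval fun i => if i = 0 then (2 : ℂ) else 1) (mul_left_cancel₀ (hJ 0) h4)
    simp [ho] at h5
    norm_num at h5

theorem isInvolution_collineated {n : ℕ} (hn : 1 ≤ n)
    {M : Matrix (Fin (n + 1)) (Fin (n + 1)) ℂ} (hM : M.det ≠ 0) :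
    IsInvolution n (collineated (hadamard n) M) := by
  have := (isInvolution_hadamard hn).conj hn
    (inversePair_linear (Matrix.mul_nonsing_inv M (isUnit_iff_ne_zero.2 hM)))
  rwa [one_mul, mul_one] at this

/-- The Hadamard inversion in the coordinates given by a diagonal matrix. -/
lemma collineated_hadamard_diagonal {n : ℕ} {a : Fin (n + 1) → ℂ} (ha : ∀ i, a i ≠ 0) (i) :
    collineated (hadamard n) (Matrix.diagonal a) i =
      C ((∏ j, a j) * (a i)⁻¹ ^ 2) * hadamard n i := by
  have hinv : (Matrix.diagonal a)⁻¹ = Matrix.diagonal fun i => (a i)⁻¹ := by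
    apply Matrix.inv_eq_right_inv
    rw [Matrix.diagonal_mul_diagonal, ← Matrix.diagonal_one]
    congr 1
    funext i
    exact mul_inv_cancel₀ (ha i)
  have hlin : ∀ b : Fin (n + 1) → ℂ, linear (Matrix.diagonal b) = fun i => C (b i) * X i := by
    intro b
    funext i
    rw [linear, Finset.sum_eq_single i]
    · simp
    · intro j _ hj; simp [Matrix.diagonal_apply_ne' _ hj]
    · simp
  rw [collineated, hinv, hlin, hlin]
  have he : (∏ j, a j) * (a i)⁻¹ ^ 2 = (a i)⁻¹ * ∏ j ∈ Finset.univ.erase i, a j := by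
    rw [← Finset.mul_prod_erase _ _ (Finset.mem_univ i)]
    have := ha i
    field_simp
  rw [he]
  simp only [comp, hadamard, map_mul, map_prod, bind₁_X_right, bind₁_C_right,
    Finset.prod_mul_distrib, mul_assoc]

/-- The tuple of the numerators of the collineated Hadamard inversions, for a matrix of
variables. -/
noncomputable def genericCollineated (n ν : ℕ) :
    Fin ν → Forms n (MvPolynomial (Fin ν × Fin (n + 1) × Fin (n + 1)) ℂ) := fun k =>
  compOver (linearOver (Matrix.adjugate (Matrix.of fun i j => X (k, i, j))))
    (compOver (fun i => map C (hadamard n i)) (linearOver (Matrix.of fun i j => X (k, i, j))))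

/-- The adjugate replaces the inverse to keep the coefficients polynomial in the matrix entries, at
the cost of a factor `det`. -/
lemma map_genericCollineated {n ν : ℕ} (c : Fin ν × Fin (n + 1) × Fin (n + 1) → ℂ)
    (hc : ∀ k, (Matrix.of fun i j => c (k, i, j)).det ≠ 0) :
    (fun k i => map (eval c) (genericCollineated n ν k i)) = fun k i =>
      C (Matrix.of fun i j => c (k, i, j)).det *
        collineated (hadamard n) (Matrix.of fun i j => c (k, i, j)) i := by
  funext k
  have h1 : (fun i => map (eval c) (map C (hadamard n i))) = hadamard n := by
    funext i
    rw [map_map, show (eval c).comp C = RingHom.id ℂ from RingHom.ext fun a => eval_C a, map_id]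
  have h2 : (Matrix.of fun i j => (X (k, i, j) : MvPolynomial _ ℂ)).map (eval c) =
      Matrix.of fun i j => c (k, i, j) := by
    ext i j
    simp
  have h3 := (RingHom.map_adjugate (eval c)
    (Matrix.of fun i j => (X (k, i, j) : MvPolynomial (Fin ν × Fin (n + 1) × Fin (n + 1)) ℂ)))
  rw [RingHom.mapMatrix_apply, RingHom.mapMatrix_apply, h2] at h3
  rw [genericCollineated, map_compOver, map_compOver, map_linearOver, map_linearOver, h1, h2, h3]
  have h4 : (Matrix.of fun i j => c (k, i, j)).adjugate =
      (Matrix.of fun i j => c (k, i, j)).det • (Matrix.of fun i j => c (k, i, j))⁻¹ := by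
    rw [Matrix.inv_def, smul_smul, Ring.mul_inverse_cancel _ (isUnit_iff_ne_zero.2 (hc k)), one_smul]
  rw [h4, linear_smul, mul_comp, bind₁_C_right]
  rfl

lemma hasCommonInvariant_genericCollineated {n ν : ℕ}
    (c : Fin ν × Fin (n + 1) × Fin (n + 1) → ℂ)
    (hc : ∀ k, (Matrix.of fun i j => c (k, i, j)).det ≠ 0) (m : ℕ) :
    HasCommonInvariant (fun k i => map (eval c) (genericCollineated n ν k i)) m ↔
      HasCommonInvariant
        (fun k => collineated (hadamard n) (Matrix.of fun i j => c (k, i, j))) m := by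
  rw [map_genericCollineated c hc]
  constructor
  · intro h
    convert h.of_mul (fun k => (Matrix.of fun i j => c (k, i, j)).det⁻¹) using 3 with k i
    rw [← mul_assoc, ← C_mul, inv_mul_cancel₀ (hc k), C_1, one_mul]
  · exact fun h => h.of_mul _

/-- Two collineated Hadamard inversions without a common non-trivial invariant. -/
lemma exists_collineated_without_invariant {n ν : ℕ} (hn : 1 ≤ n) (hν : 2 ≤ ν) :
    ∃ c : Fin ν × Fin (n + 1) × Fin (n + 1) → ℂ,
      (∀ k, (Matrix.of fun i j => c (k, i, j)).det ≠ 0) ∧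
      ∀ m, ¬ HasNontrivialInvariant
        (fun k => collineated (hadamard n) (Matrix.of fun i j => c (k, i, j))) m := by
  -- Conjugating J by this diagonal matrix gives J followed by a diagonal map proportional to the
  -- squared multipliers; the product with J is therefore diagonal.
  let a : Fin (n + 1) → ℂ := fun i => (multiplier i)⁻¹
  have ha : ∀ i, a i ≠ 0 := fun i => inv_ne_zero (multiplier_ne_zero _)
  let o : Fin ν := ⟨0, by omega⟩
  let p : Fin ν := ⟨1, by omega⟩
  have hop : o ≠ p := by simp [o, p]
  let A : Fin ν → Fin (n + 1) → ℂ := fun k => if k = p then a else fun _ => 1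
  have hA : ∀ k i, A k i ≠ 0 := by
    intro k i
    by_cases h : k = p
    · simpa [A, h] using ha i
    · simp [A, h]
  refine ⟨fun x => Matrix.diagonal (A x.1) x.2.1 x.2.2, fun k => ?_, fun m => ?_⟩
  · change (Matrix.diagonal (A k)).det ≠ 0
    rw [Matrix.det_diagonal]
    exact Finset.prod_ne_zero_iff.2 fun i _ => hA k i
  · change ¬ HasNontrivialInvariant (fun k => collineated (hadamard n) (Matrix.diagonal (A k))) m
    rintro ⟨P, Q, hP, hQ, hQ0, hPQ, hinv⟩
    obtain ⟨ψ, hψ, hJ⟩ := (sameMap_ident_iff hn _).1 (isInvolution_hadamard hn).square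
    have hw := (hinv [p, o]).2
    simp only [word, comp_ident] at hw
    let mo : MonomialOrder (Fin (n + 1)) := MonomialOrder.lex
    have hprod : ∏ j, a j ≠ 0 := Finset.prod_ne_zero_iff.2 fun i _ => ha i
    have hmul : ∀ i : Fin (n + 1), multiplier i ^ 2 ≠ 0 := fun i =>
      pow_ne_zero _ (multiplier_ne_zero _)
    have hF : comp (collineated (hadamard n) (Matrix.diagonal (A p)))
        (collineated (hadamard n) (Matrix.diagonal (A o))) =
        fun i : Fin (n + 1) => C ((∏ j, a j) * multiplier i ^ 2) * (ψ * X i) := by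
      have h1 : collineated (hadamard n) (Matrix.diagonal (A o)) = hadamard n := by
        funext i
        rw [collineated_hadamard_diagonal (hA o)]
        simp [A, hop]
      rw [h1]
      funext i
      rw [comp, collineated_hadamard_diagonal (hA p), map_mul, bind₁_C_right, ← hJ]
      simp [A, a, comp]
    rw [hF] at hw
    have hlψ := mo.leadingCoeff_ne_zero_iff.2 hψ
    refine hPQ (eq_C_mul_of_invariant mo
      (l := fun i => ((∏ j, a j) * mo.leadingCoeff ψ) * multiplier i ^ 2) (γ := mo.degree ψ)
      ?_ ?_ ?_ ?_ hP hQ hQ0 hw)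
    · exact fun i => mul_ne_zero (mul_ne_zero hprod hlψ) (hmul i)
    · intro i
      rw [← smul_eq_C_mul, mo.degree_smul_of_isRegular (IsRegular.of_ne_zero
        (mul_ne_zero hprod (hmul i))), mo.degree_mul hψ (X_ne_zero _), mo.degree_X]
    · intro i
      rw [mo.leadingCoeff_mul, mo.leadingCoeff_C, mo.leadingCoeff_mul, mo.leadingCoeff_X]
      ring
    · exact fun α β h => multiplier_independent (mul_ne_zero hprod hlψ) two_ne_zero α β h

/-- The group generated by very general collineated copies of the Hadamard inversion has no
non-trivial invariant. -/
theorem veryGeneral_collineated {n ν : ℕ} (hn : 1 ≤ n) (hν : 2 ≤ ν) :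
    VeryGeneral (fun c : Fin ν × Fin (n + 1) × Fin (n + 1) → ℂ =>
      (∀ k, (Matrix.of fun i j => c (k, i, j)).det ≠ 0) ∧
      (∀ k, IsInvolution n
        (collineated (hadamard n) (Matrix.of fun i j => c (k, i, j)))) ∧
      ∀ m, ¬ HasNontrivialInvariant
        (fun k => collineated (hadamard n) (Matrix.of fun i j => c (k, i, j))) m) := by
  obtain ⟨c₀, hdet₀, h₀⟩ := exists_collineated_without_invariant (n := n) hn hν
  have hex : ∀ m, ∃ s ∈ resultants (plueckerRelations (DegExp (Fin (n + 1)) m) _ ∪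
      invarianceEquations (genericCollineated n ν) m), eval c₀ s ≠ 0 := by
    intro m
    by_contra! hall
    refine h₀ m ?_
    rw [hasNontrivialInvariant_iff hn fun k => isInvolution_collineated hn (hdet₀ k),
      ← hasCommonInvariant_genericCollineated c₀ hdet₀]
    exact (hasCommonInvariant_iff_resultants _ _ m).2 hall
  choose s hs hs0 using hex
  let D : MvPolynomial (Fin ν × Fin (n + 1) × Fin (n + 1)) ℂ :=
    ∏ k, (Matrix.of fun i j => X (k, i, j)).det
  have hD : ∀ c, eval c D = ∏ k, (Matrix.of fun i j => c (k, i, j)).det := by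
    intro c
    rw [map_prod]
    refine Finset.prod_congr rfl fun k _ => ?_
    rw [RingHom.map_det]
    congr 1
    ext i j
    simp
  -- Index 0 excludes singular matrices, index m + 1 excludes invariants of degree m.
  refine ⟨fun j => Nat.casesOn j D s, ?_, fun c hc => ?_⟩
  · rintro (_ | m) h0
    · have := hD c₀
      rw [show D = 0 from h0, map_zero] at this
      exact Finset.prod_ne_zero_iff.2 (fun k _ => hdet₀ k) this.symm
    · apply hs0 m
      rw [show s m = 0 from h0, map_zero]
  · have hdet : ∀ k, (Matrix.of fun i j => c (k, i, j)).det ≠ 0 := by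
      have : eval c D ≠ 0 := hc 0
      rw [hD c] at this
      exact fun k => Finset.prod_ne_zero_iff.1 this k (Finset.mem_univ k)
    have hinv := fun k => isInvolution_collineated hn (hdet k)
    refine ⟨hdet, hinv, fun m h => hc (m + 1) ?_⟩
    rw [hasNontrivialInvariant_iff hn hinv, ← hasCommonInvariant_genericCollineated c hdet] at h
    exact (hasCommonInvariant_iff_resultants _ _ m).1 h _ (hs m)

end Cremona

/-! ### Bounded generation of SL by transvections. -/

namespace Cremona

open MvPolynomial

section BoundedGeneration

open scoped Pointwise Matrix

variable {m : ℕ} {q : Set (Matrix (Fin m) (Fin m) ℂ) → Prop}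

/-- The product of the one-parameter groups over all pairs of indices; each factor contains 1, so
each single transvection lies in the product. -/
lemma exists_set_transvections (h1 : q {1})
    (hmul : ∀ U V, q U → q V → q (U * V))
    (hT : ∀ i j : Fin m, i ≠ j → q (Set.range (Matrix.transvection i j))) :
    ∃ T, q T ∧ 1 ∈ T ∧ ∀ i j : Fin m, i ≠ j → ∀ c, Matrix.transvection i j c ∈ T := by
  have key : ∀ s : Finset (Fin m × Fin m), ∃ T, q T ∧ 1 ∈ T ∧
      ∀ p ∈ s, p.1 ≠ p.2 → ∀ c, Matrix.transvection p.1 p.2 c ∈ T := by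
    intro s
    induction s using Finset.induction_on with
    | empty => exact ⟨{1}, h1, rfl, by simp⟩
    | insert p s _ ih =>
      obtain ⟨T, hqT, hone, hs⟩ := ih
      by_cases hp : p.1 = p.2
      · refine ⟨T, hqT, hone, fun p' hp' hne => ?_⟩
        rcases Finset.mem_insert.1 hp' with rfl | h
        · exact absurd hp hne
        · exact hs p' h hne
      · refine ⟨Set.range (Matrix.transvection p.1 p.2) * T, hmul _ _ (hT _ _ hp) hqT, ?_, ?_⟩
        · exact ⟨1, ⟨0, Matrix.transvection_zero _ _⟩, 1, hone, one_mul 1⟩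
        · intro p' hp' hne c
          rcases Finset.mem_insert.1 hp' with rfl | h
          · exact ⟨_, ⟨c, rfl⟩, 1, hone, mul_one _⟩
          · exact ⟨1, ⟨0, Matrix.transvection_zero _ _⟩, _, hs p' h hne c, one_mul _⟩
  obtain ⟨T, hqT, hone, hs⟩ := key Finset.univ
  exact ⟨T, hqT, hone, fun i j hij => hs (i, j) (Finset.mem_univ _) hij⟩

/-- 1 + v e_kᵀ is the product of the transvections at (i, k) with parameters v_i, for i ≠ k. -/
lemma exists_set_columns (h1 : q {1})
    (hmul : ∀ U V, q U → q V → q (U * V))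
    (hT : ∀ i j : Fin m, i ≠ j → q (Set.range (Matrix.transvection i j))) (k : Fin m) :
    ∃ T, q T ∧ ∀ v : Fin m → ℂ, v k = 0 → 1 + Matrix.vecMulVec v (Pi.single k 1) ∈ T := by
  have key : ∀ s : Finset (Fin m), ∃ T, q T ∧ ∀ v : Fin m → ℂ, v k = 0 → (∀ i ∉ s, v i = 0) →
      1 + Matrix.vecMulVec v (Pi.single k 1) ∈ T := by
    intro s
    induction s using Finset.induction_on with
    | empty =>
      refine ⟨{1}, h1, fun v _ hv => ?_⟩
      have : v = 0 := funext fun i => hv i (Finset.notMem_empty i)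
      simp [this]
    | insert i s _ ih =>
      obtain ⟨T, hqT, hs⟩ := ih
      by_cases hik : i = k
      · refine ⟨T, hqT, fun v hvk hv => hs v hvk fun j hj => ?_⟩
        by_cases hji : j = i
        · rw [hji, hik, hvk]
        · exact hv j (by simp [hji, hj])
      · refine ⟨Set.range (Matrix.transvection i k) * T, hmul _ _ (hT _ _ hik) hqT, ?_⟩
        intro v hvk hv
        refine ⟨_, ⟨v i, rfl⟩, _, hs (Function.update v i 0) ?_ ?_, ?_⟩
        · rw [Function.update_of_ne (Ne.symm hik), hvk]
        · intro j hj
          by_cases hji : j = i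
          · simp [hji]
          · rw [Function.update_of_ne hji]
            exact hv j (by simp [hji, hj])
        · ext r c
          by_cases hr : r = i
          · subst hr
            simp only [Matrix.transvection_mul_apply_same, Matrix.add_apply,
              Matrix.vecMulVec_apply, Function.update_self, Matrix.one_apply]
            rw [Function.update_of_ne (Ne.symm hik), hvk]
            simp [Pi.single_apply, eq_comm]
          · simp only [Matrix.transvection_mul_apply_of_ne _ _ _ _ hr, Matrix.add_apply,
              Matrix.vecMulVec_apply, Function.update_of_ne hr]
  obtain ⟨T, hqT, hs⟩ := key Finset.univ
  exact ⟨T, hqT, fun v hv => hs v hv (by simp)⟩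

/-- The matrices of determinant one with the same first `k` columns as the unit matrix. -/
def unitColumns (m k : ℕ) : Set (Matrix (Fin m) (Fin m) ℂ) :=
  {M | M.det = 1 ∧ ∀ i j : Fin m, (j : ℕ) < k → M i j = (1 : Matrix (Fin m) (Fin m) ℂ) i j}

lemma transvection_mul_mem_unitColumns {k : ℕ} {M : Matrix (Fin m) (Fin m) ℂ}
    (hM : M ∈ unitColumns m k) {i r : Fin m} (hir : i ≠ r) (hr : k ≤ r) (c : ℂ) :
    Matrix.transvection i r c * M ∈ unitColumns m k := by
  refine ⟨by rw [Matrix.det_mul, Matrix.det_transvection_of_ne _ _ hir, hM.1, one_mul], ?_⟩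
  intro a b hb
  by_cases ha : a = i
  · subst ha
    rw [Matrix.transvection_mul_apply_same, hM.2 _ _ hb, hM.2 _ _ hb,
      Matrix.one_apply_ne (i := r) (by rintro rfl; omega), mul_zero, add_zero]
  · rw [Matrix.transvection_mul_apply_of_ne _ _ _ _ ha, hM.2 _ _ hb]

lemma transvection_neg_mul_cancel {i r : Fin m} (hir : i ≠ r) (c : ℂ)
    (M : Matrix (Fin m) (Fin m) ℂ) :
    Matrix.transvection i r (-c) * (Matrix.transvection i r c * M) = M := by
  rw [← mul_assoc, Matrix.transvection_mul_transvection_same _ _ hir, neg_add_cancel,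
    Matrix.transvection_zero, one_mul]

/-- Take for v the k-th column without its diagonal entry: 1 − v e_kᵀ clears that column, and it is
inverse to 1 + v e_kᵀ because v_k = 0. -/
lemma exists_column_of_diag_eq_one {M : Matrix (Fin m) (Fin m) ℂ} (k : Fin m)
    (hM : M ∈ unitColumns m k) (hk : M k k = 1) :
    ∃ v : Fin m → ℂ, v k = 0 ∧ ∃ M' ∈ unitColumns m (k + 1),
      M = (1 + Matrix.vecMulVec v (Pi.single k 1)) * M' := by
  let v : Fin m → ℂ := Function.update (fun i => M i k) k 0
  have hvk : v k = 0 := by simp [v]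
  have hmul : ∀ (w : Fin m → ℂ) (N : Matrix (Fin m) (Fin m) ℂ) (a b),
      ((1 + Matrix.vecMulVec w (Pi.single k 1)) * N) a b = N a b + w a * N k b := by
    intro w N a b
    rw [add_mul, one_mul, Matrix.add_apply, Matrix.mul_apply, Finset.sum_eq_single k]
    · simp [Matrix.vecMulVec_apply]
    · intro j _ hj; simp [Matrix.vecMulVec_apply, hj]
    · simp
  have hcancel : M = (1 + Matrix.vecMulVec v (Pi.single k 1)) *
      ((1 + Matrix.vecMulVec (-v) (Pi.single k 1)) * M) := by
    ext a b
    rw [hmul, hmul, hmul]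
    simp [hvk]
  have hdet : ∀ w : Fin m → ℂ, w k = 0 →
      (1 + Matrix.vecMulVec w (Pi.single k 1)).det = 1 := by
    intro w hw
    rw [Matrix.vecMulVec_eq Unit, Matrix.det_one_add_replicateCol_mul_replicateRow]
    simp [hw]
  refine ⟨v, hvk, _, ⟨?_, ?_⟩, hcancel⟩
  · rw [Matrix.det_mul, hM.1, hdet _ (by simp [hvk]), one_mul]
  · intro a b hb
    rw [hmul]
    by_cases hbk : b = k
    · subst hbk
      by_cases hab : a = b
      · subst hab; simp [hvk, hk]
      · simp [v, hab, hk]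
    · have hlt : (b : ℕ) < k := by
        have : (b : ℕ) ≠ k := fun h => hbk (Fin.ext h)
        omega
      rw [hM.2 _ _ hlt, hM.2 _ _ hlt, Matrix.one_apply_ne (Ne.symm hbk), mul_zero, add_zero]

/-- If column k vanishes below the diagonal, its diagonal entry is nonzero, since otherwise the
column would be a combination of the preceding unit columns. Adding row k to row k' then helps. -/
lemma exists_transvection_below {M : Matrix (Fin m) (Fin m) ℂ} (k k' : Fin m) (hkk : k < k')
    (hM : M ∈ unitColumns m k) {T : Set (Matrix (Fin m) (Fin m) ℂ)} (hone : 1 ∈ T)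
    (hT : ∀ i j : Fin m, i ≠ j → ∀ c, Matrix.transvection i j c ∈ T) :
    ∃ E ∈ T, ∃ M' ∈ unitColumns m k, M = E * M' ∧ ∃ i, k < i ∧ M' i k ≠ 0 := by
  by_cases h : ∃ i, k < i ∧ M i k ≠ 0
  · exact ⟨1, hone, M, hM, (one_mul M).symm, h⟩
  · push Not at h
    have hkk0 : M k k ≠ 0 := by
      intro h0
      have hdet : M.det = 0 := by
        rw [← Matrix.exists_mulVec_eq_zero_iff]
        refine ⟨Pi.single k 1 - fun j => if j < k then M j k else 0, ?_, ?_⟩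
        · intro hz
          have := congrFun hz k
          simp at this
        · rw [Matrix.mulVec_sub, sub_eq_zero]
          ext i
          have e1 : (M *ᵥ fun j => if j < k then M j k else 0) i =
              ((1 : Matrix (Fin m) (Fin m) ℂ) *ᵥ fun j => if j < k then M j k else 0) i := by
            simp only [Matrix.mulVec, dotProduct]
            refine Finset.sum_congr rfl fun j _ => ?_
            split_ifs with hj
            · rw [hM.2 i j hj]
            · simp
          rw [e1, Matrix.one_mulVec, Matrix.mulVec_single_one, Matrix.col_apply]
          split_ifs with hi
          · rfl
          rw [not_lt] at hi
          rcases hi.eq_or_lt with rfl | hlt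
          · exact h0
          · exact h i hlt
      rw [hM.1] at hdet
      exact one_ne_zero hdet
    refine ⟨_, hT k' k hkk.ne' (-1), _,
      transvection_mul_mem_unitColumns hM hkk.ne' le_rfl 1,
      (transvection_neg_mul_cancel hkk.ne' 1 M).symm, k', hkk, ?_⟩
    rw [Matrix.transvection_mul_apply_same, h k' hkk, zero_add, one_mul]
    exact hkk0

/-- The special linear group is a product of finitely many one-parameter groups of
transvections. -/
theorem special_linear_bounded_induction
    (hmono : ∀ U V, U ⊆ V → q V → q U) (h1 : q {1})
    (hmul : ∀ U V, q U → q V → q (U * V))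
    (hT : ∀ i j : Fin m, i ≠ j → q (Set.range (Matrix.transvection i j))) :
    q {M | M.det = 1} := by
  obtain ⟨T, hqT, hone, hTmem⟩ := exists_set_transvections h1 hmul hT
  -- Gaussian elimination, by induction on the number d of columns still to be reduced.
  have key : ∀ d ≤ m, q (unitColumns m (m - d)) := by
    intro d
    induction d with
    | zero =>
      intro _
      refine hmono _ _ ?_ h1
      rintro M ⟨-, hM⟩
      exact Matrix.ext fun i j => hM i j (by simp)
    | succ d ih =>
      intro hd
      let k : Fin m := ⟨m - (d + 1), by omega⟩
      have hk1 : m - d = (k : ℕ) + 1 := by simp only [k]; omega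
      have ih' := ih (by omega)
      rw [hk1] at ih'
      obtain ⟨L, hqL, hL⟩ := exists_set_columns h1 hmul hT k
      refine hmono _ _ ?_ (hmul _ _ hqT (hmul _ _ hqT (hmul _ _ hqL ih')))
      intro M hM
      change M ∈ unitColumns m k at hM
      have hfin : ∀ N ∈ unitColumns m k, N k k = 1 → N ∈ L * unitColumns m (k + 1) := by
        intro N hN hNk
        obtain ⟨v, hv, N', hN', rfl⟩ := exists_column_of_diag_eq_one k hN hNk
        exact ⟨_, hL v hv, N', hN', rfl⟩
      by_cases hlast : (k : ℕ) + 1 < m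
      · obtain ⟨E, hE, M', hM', rfl, i, hki, hi⟩ :=
          exists_transvection_below k ⟨k + 1, hlast⟩ (by simp [Fin.lt_def]) hM hone hTmem
        refine Set.mul_mem_mul hE ?_
        -- Adding c times row i to row k makes the diagonal entry 1.
        let c : ℂ := (1 - M' k k) / M' i k
        refine ⟨_, hTmem k i hki.ne (-c), _, hfin _
          (transvection_mul_mem_unitColumns hM' hki.ne hki.le c) ?_,
          transvection_neg_mul_cancel hki.ne c M'⟩
        rw [Matrix.transvection_mul_apply_same]
        simp only [c]
        field_simp
        ring
      -- In the last column there is no row below, but M is triangular, so its determinant is the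
      -- remaining diagonal entry; both transvection factors are 1.
      · refine ⟨1, hone, _, ⟨1, hone, _, hfin M hM ?_, rfl⟩, by simp⟩
        have hlt : ∀ j : Fin m, j ≠ k → (j : ℕ) < k := by
          intro j hj
          have : (j : ℕ) ≠ k := fun h => hj (Fin.ext h)
          omega
        have htri : M.BlockTriangular id := by
          intro i j hij
          simp only [id] at hij
          have hj : j ≠ k := by
            rintro rfl
            have := i.2
            have := Fin.lt_def.1 hij
            omega
          rw [hM.2 i j (hlt j hj), Matrix.one_apply_ne hij.ne']
        have hdet := hM.1
        rw [Matrix.det_of_isUpperTriangular htri, Finset.prod_eq_single k] at hdet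
        · exact hdet
        · intro j _ hj
          rw [hM.2 j j (hlt j hj), Matrix.one_apply_eq]
        · simp
  have := key m le_rfl
  refine hmono _ _ (fun M hM => ?_) this
  exact ⟨hM, fun i j hj => by omega⟩

end BoundedGeneration

end Cremona

/-! ### Algebraic families of birational transformations. -/

namespace Cremona

open MvPolynomial

lemma InversePair.of_member {n N a b : ℕ} {G H : Forms n (MvPolynomial (Fin N) ℂ)}
    (h : IsBirationalFamily a b G H) (t : Fin N → ℂ) :
    InversePair a b (member G t) (member H t) :=
  ⟨fun i => (h.homogeneous i).map _, fun i => (h.homogeneous_inv i).map _, h.left_inv t,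
    h.right_inv t⟩

/-- All the pairs in `T` are members of one algebraic family of birational transformations and
their inverses. -/
def Parametrized {n : ℕ} (T : Set (Forms n ℂ × Forms n ℂ)) : Prop :=
  ∃ (N a b : ℕ) (G H : Forms n (MvPolynomial (Fin N) ℂ)), IsBirationalFamily a b G H ∧
    ∀ p ∈ T, ∃ t, member G t = p.1 ∧ member H t = p.2

lemma Parametrized.mono {n : ℕ} {T T' : Set (Forms n ℂ × Forms n ℂ)} (h : T ⊆ T')
    (hT : Parametrized T') : Parametrized T := by
  obtain ⟨N, a, b, G, H, hGH, ht⟩ := hT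
  exact ⟨N, a, b, G, H, hGH, fun p hp => ht p (h hp)⟩

lemma Parametrized.inversePair {n : ℕ} {T : Set (Forms n ℂ × Forms n ℂ)} (hT : Parametrized T)
    {p : Forms n ℂ × Forms n ℂ} (hp : p ∈ T) : ∃ a b, InversePair a b p.1 p.2 := by
  obtain ⟨N, a, b, G, H, hGH, ht⟩ := hT
  obtain ⟨t, h1, h2⟩ := ht p hp
  exact ⟨a, b, h1 ▸ h2 ▸ InversePair.of_member hGH t⟩

/-- Renaming of the parameters of a family. -/
noncomputable def renameParameters {n N : ℕ} {τ : Type} (f : Fin N → τ)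
    (F : Forms n (MvPolynomial (Fin N) ℂ)) : Forms n (MvPolynomial τ ℂ) :=
  fun i => map (rename f : _ →ₐ[ℂ] _).toRingHom (F i)

lemma map_renameParameters {n N : ℕ} {τ : Type} (F : Forms n (MvPolynomial (Fin N) ℂ))
    (f : Fin N → τ) (t : τ → ℂ) :
    (fun i => map (eval t) (renameParameters f F i)) = member F (t ∘ f) := by
  funext i
  rw [renameParameters, map_map, member]
  congr 2
  refine RingHom.ext fun p => ?_
  exact eval_rename f t p

lemma member_renameParameters {n N N' : ℕ} (F : Forms n (MvPolynomial (Fin N) ℂ))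
    (f : Fin N → Fin N') (t : Fin N' → ℂ) :
    member (renameParameters f F) t = member F (t ∘ f) :=
  map_renameParameters F f t

lemma member_compOver {n N : ℕ} (F G : Forms n (MvPolynomial (Fin N) ℂ)) (t : Fin N → ℂ) :
    member (compOver F G) t = comp (member F t) (member G t) :=
  map_compOver (eval t) F G

lemma homogeneous_compOver {n a b : ℕ} {A : Type} [CommRing A] {F G : Forms n A}
    (hF : ∀ i, (F i).IsHomogeneous b) (hG : ∀ i, (G i).IsHomogeneous a) (i) :
    (compOver F G i).IsHomogeneous (b * a) := by
  rw [mul_comm]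
  exact (hF i).aeval G hG

lemma sameMap_comp_ident {n a a' b : ℕ} (hn : 1 ≤ n) {F G H : Forms n ℂ}
    (hF : SameMap F (ident n)) (hFa : ∀ i, (F i).IsHomogeneous a)
    (hG : SameMap G (ident n)) (h : InversePair a' b G H) : SameMap (comp F G) (ident n) := by
  obtain ⟨φ, hφ, h1⟩ := (sameMap_ident_iff hn _).1 hF
  obtain ⟨ψ, hψ, h2⟩ := (sameMap_ident_iff hn _).1 hG
  rw [sameMap_ident_iff hn]
  refine ⟨bind₁ G φ * ψ, mul_ne_zero
    ((h.dominant hn).bind_factor_ne_zero (hFa 0) h1 hφ) hψ, fun i => ?_⟩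
  rw [comp, h1, map_mul, bind₁_X_right, h2, mul_assoc]

/-- The compositions of the members of two algebraic families form an algebraic family. -/
lemma Parametrized.comp {n : ℕ} (hn : 1 ≤ n) {U V : Set (Forms n ℂ × Forms n ℂ)}
    (hU : Parametrized U) (hV : Parametrized V) :
    Parametrized {p | ∃ u ∈ U, ∃ v ∈ V,
      p = (Cremona.comp u.1 v.1, Cremona.comp v.2 u.2)} := by
  obtain ⟨N, a, b, G, H, hGH, hu⟩ := hU
  obtain ⟨N', a', b', G', H', hGH', hv⟩ := hV
  let f : Fin N → Fin (N + N') := Fin.castAdd N'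
  let g : Fin N' → Fin (N + N') := Fin.natAdd N
  have h1 : ∀ t, member (compOver (renameParameters f G)
      (renameParameters g G')) t =
      Cremona.comp (member G (t ∘ f)) (member G' (t ∘ g)) := fun t => by
    rw [member_compOver, member_renameParameters, member_renameParameters]
  have h2 : ∀ t, member (compOver (renameParameters g H')
      (renameParameters f H)) t =
      Cremona.comp (member H' (t ∘ g)) (member H (t ∘ f)) := fun t => by
    rw [member_compOver, member_renameParameters, member_renameParameters]
  have hsplit : ∀ (s : Fin N → ℂ) (s' : Fin N' → ℂ),
      ∃ t : Fin (N + N') → ℂ, t ∘ f = s ∧ t ∘ g = s' := fun s s' =>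
    ⟨Fin.append s s', funext fun i => by simp [f], funext fun i => by simp [g]⟩
  have hpair : ∀ t : Fin (N + N') → ℂ, InversePair (a * a') (b' * b)
      (Cremona.comp (member G (t ∘ f)) (member G' (t ∘ g)))
      (Cremona.comp (member H' (t ∘ g)) (member H (t ∘ f))) := fun t =>
    (InversePair.of_member hGH _).comp hn (InversePair.of_member hGH' _)
  refine ⟨N + N', a * a', b' * b, compOver (renameParameters f G) (renameParameters g G'),
    compOver (renameParameters g H') (renameParameters f H), ⟨?_, ?_, fun t => ?_, fun t => ?_, ?_⟩, ?_⟩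
  · exact homogeneous_compOver (fun i => (hGH.homogeneous i).map _)
      fun i => (hGH'.homogeneous i).map _
  · exact homogeneous_compOver (fun i => (hGH'.homogeneous_inv i).map _)
      fun i => (hGH.homogeneous_inv i).map _
  · rw [h1, h2]
    exact (hpair t).left_inv
  · rw [h1, h2]
    exact (hpair t).right_inv
  · obtain ⟨s, hs⟩ := hGH.exists_ident
    obtain ⟨s', hs'⟩ := hGH'.exists_ident
    obtain ⟨t, rfl, rfl⟩ := hsplit s s'
    have hp := InversePair.of_member hGH' (t ∘ g)
    refine ⟨t, ?_⟩
    rw [h1]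
    exact sameMap_comp_ident hn hs (fun i => (hGH.homogeneous i).map _) hs' hp
  · rintro p ⟨u, hu', v, hv', rfl⟩
    obtain ⟨s, hs1, hs2⟩ := hu u hu'
    obtain ⟨s', hs1', hs2'⟩ := hv v hv'
    obtain ⟨t, rfl, rfl⟩ := hsplit s s'
    exact ⟨t, by rw [h1, hs1, hs1'], by rw [h2, hs2, hs2']⟩

lemma parametrized_ident (n : ℕ) : Parametrized {(ident n, ident n)} := by
  have h : ∀ t, member (fun i => X i : Forms n (MvPolynomial (Fin 0) ℂ)) t = ident n := fun t =>
    funext fun i => map_X _ _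
  refine ⟨0, 1, 1, fun i => X i, fun i => X i, ⟨isHomogeneous_X _, isHomogeneous_X _, fun t => ?_,
    fun t => ?_, 0, ?_⟩, fun p hp => ?_⟩
  · rw [h, comp_ident]
    exact sameMap_self_ident
  · rw [h, comp_ident]
    exact sameMap_self_ident
  · rw [h]
    exact sameMap_self_ident
  · rw [Set.mem_singleton_iff.1 hp]
    exact ⟨0, h 0, h 0⟩

/-- In the affine chart `x₀ = 1`, this is the translation of the coordinate `xᵢ` by `φ`. -/
noncomputable def shear {n : ℕ} {A : Type} [CommSemiring A] (i : Fin (n + 1)) (k : ℕ)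
    (φ : MvPolynomial (Fin (n + 1)) A) : Forms n A :=
  fun l => X 0 ^ k * X l + if l = i then φ else 0

lemma homogeneous_shear {n k : ℕ} {A : Type} [CommSemiring A] (i : Fin (n + 1))
    {φ : MvPolynomial (Fin (n + 1)) A} (hφ : φ.IsHomogeneous (k + 1)) (l) :
    (shear i k φ l).IsHomogeneous (k + 1) := by
  refine ((isHomogeneous_X_pow _ _).mul (isHomogeneous_X _ _)).add ?_
  split_ifs
  · exact hφ
  · exact isHomogeneous_zero _ _ _

/-- By `hφ` the shear preserves φ up to a power of X_0, so successive translations add. The case `k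
= 0` admits i = 0, as transvections require. -/
lemma comp_shear {n k : ℕ} {i : Fin (n + 1)} (hi : i ≠ 0 ∨ k = 0)
    {φ : MvPolynomial (Fin (n + 1)) ℂ}
    (hφ : ∀ c, bind₁ (shear i k (C c * φ)) φ = X 0 ^ (k * (k + 1)) * φ) {c c' : ℂ}
    (hc : c' + c = 0) :
    SameMap (comp (shear i k (C c' * φ)) (shear i k (C c * φ))) (ident n) := by
  have h0 : shear i k (C c * φ) 0 ^ k = X 0 ^ (k * (k + 1)) := by
    rcases hi with hi | rfl
    · rw [shear, if_neg hi.symm, add_zero, ← pow_succ, ← pow_mul, mul_comm]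
    · simp
  have hkey : ∀ l, comp (shear i k (C c' * φ)) (shear i k (C c * φ)) l =
      X 0 ^ (k * (k + 1) + k) * X l := by
    intro l
    have : comp (shear i k (C c' * φ)) (shear i k (C c * φ)) l =
        shear i k (C c * φ) 0 ^ k * shear i k (C c * φ) l +
          if l = i then C c' * bind₁ (shear i k (C c * φ)) φ else 0 := by
      rw [comp]
      conv_lhs => rw [shear]
      split_ifs <;> simp
    rw [this, h0, hφ c, shear]
    split_ifs with hl
    · have : (C c' + C c : MvPolynomial (Fin (n + 1)) ℂ) = 0 := by rw [← C_add, hc, C_0]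
      rw [pow_add]
      linear_combination X 0 ^ (k * (k + 1)) * φ * this
    · ring
  refine ⟨fun h => ?_, sameMap_self_ident.1, fun i j => ?_⟩
  · have := congrFun h 0
    rw [hkey] at this
    exact mul_ne_zero (pow_ne_zero _ (X_ne_zero _)) (X_ne_zero _) this
  · rw [hkey, hkey, ident, ident]
    ring

lemma parametrized_shear {n k : ℕ} {i : Fin (n + 1)} (hi : i ≠ 0 ∨ k = 0)
    {φ : MvPolynomial (Fin (n + 1)) ℂ} (hhom : φ.IsHomogeneous (k + 1))
    (hφ : ∀ c, bind₁ (shear i k (C c * φ)) φ = X 0 ^ (k * (k + 1)) * φ) :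
    Parametrized {p | ∃ c : ℂ, p = (shear i k (C c * φ), shear i k (C (-c) * φ))} := by
  have hmap : ∀ (t : Fin 1 → ℂ) (q : MvPolynomial (Fin 1) ℂ),
      member (shear i k (C q * map C φ)) t = shear i k (C (eval t q) * φ) := by
    intro t q
    funext l
    have h1 : map (eval t) (map C φ) = φ := by
      rw [map_map, show (eval t).comp C = RingHom.id ℂ from RingHom.ext fun a => eval_C a, map_id]
    rw [member, shear, shear]
    split_ifs <;> simp [h1]
  refine ⟨1, k + 1, k + 1, shear i k (C (X 0) * map C φ), shear i k (C (-X 0) * map C φ),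
    ⟨homogeneous_shear i ((hhom.map C).C_mul _), homogeneous_shear i ((hhom.map C).C_mul _),
      fun t => ?_, fun t => ?_, 0, ?_⟩, ?_⟩
  · rw [hmap, hmap]
    exact comp_shear hi hφ (by simp)
  · rw [hmap, hmap]
    exact comp_shear hi hφ (by simp)
  · rw [hmap]
    refine ⟨fun h => ?_, sameMap_self_ident.1, fun a b => ?_⟩
    · have := congrFun h 0
      simp [shear] at this
    · simp [shear, ident]
      ring
  · rintro p ⟨c, rfl⟩
    exact ⟨fun _ => c, by rw [hmap]; simp, by rw [hmap]; simp⟩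

lemma linear_transvection {n : ℕ} (i j : Fin (n + 1)) (c : ℂ) :
    linear (Matrix.transvection i j c) = shear i 0 (C c * X j) := by
  funext l
  simp only [linear, Matrix.transvection, Matrix.add_apply, C_add, add_mul,
    Finset.sum_add_distrib, shear, pow_zero, one_mul]
  congr 1
  · exact congrFun linear_one l
  · rw [Finset.sum_eq_single j]
    · by_cases hl : l = i
      · subst hl; simp
      · simp [hl, Matrix.single_apply_of_row_ne (Ne.symm hl)]
    · intro k _ hk
      simp [Matrix.single_apply_of_col_ne _ _ (Ne.symm hk)]
    · simp

lemma inv_transvection {m : ℕ} {i j : Fin m} (hij : i ≠ j) (c : ℂ) :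
    (Matrix.transvection i j c)⁻¹ = Matrix.transvection i j (-c) := by
  apply Matrix.inv_eq_right_inv
  rw [Matrix.transvection_mul_transvection_same _ _ hij, add_neg_cancel, Matrix.transvection_zero]

/-- The special linear group is an algebraic family. -/
theorem parametrized_special_linear {n : ℕ} (hn : 1 ≤ n) :
    Parametrized {p | ∃ M : Matrix (Fin (n + 1)) (Fin (n + 1)) ℂ, M.det = 1 ∧
      p = (linear M, linear M⁻¹)} := by
  refine special_linear_bounded_induction
    (q := fun U => Parametrized {p | ∃ M ∈ U, p = (linear M, linear M⁻¹)}) ?_ ?_ ?_ ?_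
  · intro U V hUV hV
    refine Parametrized.mono ?_ hV
    rintro p ⟨M, hM, hp⟩
    exact ⟨M, hUV hM, hp⟩
  · refine (parametrized_ident n).mono ?_
    rintro p ⟨M, rfl, rfl⟩
    simp [linear_one]
  · intro U V hU hV
    refine (hU.comp hn hV).mono ?_
    rintro p ⟨_, ⟨M, hM, N, hN, rfl⟩, rfl⟩
    refine ⟨_, ⟨M, hM, rfl⟩, _, ⟨N, hN, rfl⟩, ?_⟩
    simp only [comp_linear, Matrix.mul_inv_rev]
  · intro i j hij
    refine (parametrized_shear (i := i) (k := 0) (φ := X j) (Or.inr rfl) (isHomogeneous_X _ _)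
      fun c => ?_).mono ?_
    · simp [shear, hij.symm]
    · rintro p ⟨_, ⟨c, rfl⟩, rfl⟩
      refine ⟨c, ?_⟩
      rw [inv_transvection hij, linear_transvection, linear_transvection]

end Cremona

/-! ### Differentials through dual numbers. -/

namespace Cremona

open MvPolynomial Matrix TrivSqZeroExt

/-- The value of a tuple of forms at a point with coordinates in the dual numbers. -/
noncomputable def evalDual {n : ℕ} (F : Forms n ℂ) (z : Fin (n + 1) → DualNumber ℂ) :
    Fin (n + 1) → DualNumber ℂ := fun i => aeval z (F i)

lemma evalDual_comp {n : ℕ} (F G : Forms n ℂ) (z : Fin (n + 1) → DualNumber ℂ) :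
    evalDual (comp F G) z = evalDual F (evalDual G z) := by
  funext i
  simp only [evalDual, comp, aeval_bind₁]
  rfl

lemma evalDual_ident {n : ℕ} (z : Fin (n + 1) → DualNumber ℂ) : evalDual (ident n) z = z := by
  funext i
  simp [evalDual, ident]

lemma evalDual_mul {n d : ℕ} {F : Forms n ℂ} (hF : ∀ i, (F i).IsHomogeneous d) (c : DualNumber ℂ)
    (z : Fin (n + 1) → DualNumber ℂ) :
    evalDual F (fun i => c * z i) = fun i => c ^ d * evalDual F z i := by
  funext i
  simp only [evalDual, aeval_mul_homogeneous (hF i)]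

/-- The tangent vector `y` at the point `[1 : 0 : … : 0]`. -/
noncomputable def basePoint {n : ℕ} (y : Fin n → ℂ) : Fin (n + 1) → DualNumber ℂ :=
  Fin.cons 1 fun i => inr (y i)

/-- The image of the tangent vector `y` under the linear map `E`. -/
noncomputable def framePoint {n : ℕ} (E : Matrix (Fin (n + 1)) (Fin (n + 1)) ℂ) (y : Fin n → ℂ) :
    Fin (n + 1) → DualNumber ℂ := evalDual (linear E) (basePoint y)

lemma framePoint_one {n : ℕ} (y : Fin n → ℂ) :
    framePoint (1 : Matrix (Fin (n + 1)) (Fin (n + 1)) ℂ) y = basePoint y := by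
  rw [framePoint, linear_one, evalDual_ident]

lemma evalDual_linear_framePoint {n : ℕ} (M E : Matrix (Fin (n + 1)) (Fin (n + 1)) ℂ)
    (y : Fin n → ℂ) : evalDual (linear M) (framePoint E y) = framePoint (M * E) y := by
  rw [framePoint, ← evalDual_comp, comp_linear, framePoint]

/-- The rational map `F` maps the point `E e₀` to `E' e₀`, and `T` is its differential with respect
to the frames `E` and `E'` of the tangent spaces. -/
def Jet {n : ℕ} (F : Forms n ℂ) (E E' : Matrix (Fin (n + 1)) (Fin (n + 1)) ℂ)
    (T : Matrix (Fin n) (Fin n) ℂ) : Prop :=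
  ∀ y, ∃ η : DualNumber ℂ, IsUnit η ∧
    evalDual F (framePoint E y) = fun i => η * framePoint E' (T *ᵥ y) i

lemma Jet.comp {n d : ℕ} {F G : Forms n ℂ} {E E' E'' : Matrix (Fin (n + 1)) (Fin (n + 1)) ℂ}
    {T T' : Matrix (Fin n) (Fin n) ℂ} (hG : Jet G E' E'' T') (hd : ∀ i, (G i).IsHomogeneous d)
    (hF : Jet F E E' T) : Jet (Cremona.comp G F) E E'' (T' * T) := by
  intro y
  obtain ⟨η, hη, h1⟩ := hF y
  obtain ⟨η', hη', h2⟩ := hG (T *ᵥ y)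
  refine ⟨η ^ d * η', (hη.pow d).mul hη', ?_⟩
  rw [evalDual_comp, h1, evalDual_mul hd, h2, mulVec_mulVec]
  funext i
  rw [mul_assoc]

lemma jet_linear {n : ℕ} {M E E' : Matrix (Fin (n + 1)) (Fin (n + 1)) ℂ} (h : M * E = E') :
    Jet (linear M) E E' 1 := by
  intro y
  refine ⟨1, isUnit_one, ?_⟩
  rw [evalDual_linear_framePoint, h, one_mulVec]
  simp

lemma homogeneous_ident (n : ℕ) (i) : (ident n i).IsHomogeneous 1 := isHomogeneous_X _ i

/-- Change of the frame at the source and at the target. -/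
lemma Jet.change {n d : ℕ} {F : Forms n ℂ} {E₁ E E' E₁' : Matrix (Fin (n + 1)) (Fin (n + 1)) ℂ}
    {T S S' : Matrix (Fin n) (Fin n) ℂ} (hF : Jet F E E' T) (hd : ∀ i, (F i).IsHomogeneous d)
    (h : Jet (ident n) E₁ E S) (h' : Jet (ident n) E' E₁' S') : Jet F E₁ E₁' (S' * (T * S)) := by
  have := h'.comp (homogeneous_ident n) (hF.comp hd h)
  rwa [comp_ident, ident_comp] at this

lemma Jet.ident_mul {n : ℕ} {E E' : Matrix (Fin (n + 1)) (Fin (n + 1)) ℂ}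
    {S : Matrix (Fin n) (Fin n) ℂ} (h : Jet (ident n) E E' S)
    (M : Matrix (Fin (n + 1)) (Fin (n + 1)) ℂ) : Jet (ident n) (M * E) (M * E') S := by
  intro y
  obtain ⟨η, hη, h1⟩ := h y
  refine ⟨η, hη, ?_⟩
  rw [evalDual_ident] at h1 ⊢
  rw [← evalDual_linear_framePoint, h1, evalDual_mul (isHomogeneous_linear M),
    evalDual_linear_framePoint, pow_one]

lemma jet_ident_smul {n : ℕ} (E : Matrix (Fin (n + 1)) (Fin (n + 1)) ℂ) {s : ℂ} (hs : s ≠ 0) :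
    Jet (ident n) (s • E) E 1 := by
  intro y
  refine ⟨algebraMap ℂ _ s, (isUnit_iff_ne_zero.2 hs).map _, ?_⟩
  rw [evalDual_ident, one_mulVec, framePoint, linear_smul]
  funext i
  simp [evalDual, framePoint]

lemma jet_ident_smul' {n : ℕ} (E : Matrix (Fin (n + 1)) (Fin (n + 1)) ℂ) {s : ℂ} (hs : s ≠ 0) :
    Jet (ident n) E (s • E) 1 := by
  have := jet_ident_smul (s • E) (inv_ne_zero hs)
  rwa [smul_smul, inv_mul_cancel₀ hs, one_smul] at this

/-- First-order Taylor expansion: since ε² = 0, multiplication of dual numbers is the Leibniz rule.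
-/
lemma aeval_basePoint {n : ℕ} (p : MvPolynomial (Fin (n + 1)) ℂ) (y : Fin n → ℂ) :
    aeval (basePoint y) p = inl (eval (Pi.single 0 1) p) +
      inr ((fun j : Fin n => eval (Pi.single 0 1) (pderiv j.succ p)) ⬝ᵥ y) := by
  induction p using MvPolynomial.induction_on with
  | C a => ext <;> simp [TrivSqZeroExt.algebraMap_eq_inl, dotProduct]
  | add p q hp hq =>
    rw [map_add, hp, hq]
    ext <;> simp [dotProduct, add_mul, Finset.sum_add_distrib]
  | mul_X p i hp =>
    rw [map_mul, hp, aeval_X]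
    refine Fin.cases ?_ (fun k => ?_) i
    · ext <;> simp [basePoint, Derivation.leibniz, pderiv_X, dotProduct]
    · ext <;> simp [basePoint, Derivation.leibniz, pderiv_X, dotProduct, Pi.single_apply,
        apply_ite (eval (Pi.single (0 : Fin (n + 1)) (1 : ℂ))), mul_comm]

lemma exists_aeval_basePoint {n : ℕ} (p : MvPolynomial (Fin (n + 1)) ℂ) :
    ∃ w : Fin n → ℂ, ∀ y, aeval (basePoint y) p =
      inl (eval (Pi.single 0 1) p) + inr (w ⬝ᵥ y) :=
  ⟨_, aeval_basePoint p⟩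

lemma isUnit_of_fst_ne_zero {η : DualNumber ℂ} (h : fst η ≠ 0) : IsUnit η :=
  TrivSqZeroExt.isUnit_iff_isUnit_fst.2 (isUnit_iff_ne_zero.2 h)

/-- A transformation which is defined at `[1 : 0 : … : 0]` has a differential. -/
lemma exists_jet {n : ℕ} {F : Forms n ℂ} {E E' : Matrix (Fin (n + 1)) (Fin (n + 1)) ℂ}
    (hE' : E'.det ≠ 0) {c : ℂ} (hc : c ≠ 0)
    (h : ∀ i, eval (E *ᵥ Pi.single 0 1) (F i) = c * (E' *ᵥ Pi.single 0 1) i) :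
    ∃ T, Jet F E E' T := by
  let K := comp (linear E'⁻¹) (comp F (linear E))
  have hmul : E' * E'⁻¹ = 1 := mul_nonsing_inv _ (isUnit_iff_ne_zero.2 hE')
  have heval : ∀ (M : Matrix (Fin (n + 1)) (Fin (n + 1)) ℂ) (x : Fin (n + 1) → ℂ),
      (fun i => eval x (linear M i)) = M *ᵥ x := by
    intro M x
    funext i
    simp [linear, mulVec, dotProduct]
  have hcomp : ∀ (A B : Forms n ℂ) (x : Fin (n + 1) → ℂ) (i),
      eval x (comp A B i) = eval (fun j => eval x (B j)) (A i) := fun A B x i =>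
    eval₂Hom_bind₁ _ _ _ _
  have hK : ∀ i, eval (Pi.single 0 1) (K i) = c * (Pi.single 0 1 : Fin (n + 1) → ℂ) i := by
    intro i
    have h1 : (fun j => eval (Pi.single 0 1) (comp F (linear E) j)) =
        c • (E' *ᵥ Pi.single 0 1) := by
      funext j
      rw [hcomp, heval, h]
      rfl
    rw [hcomp, h1]
    have h2 := congrFun (heval E'⁻¹ (c • (E' *ᵥ Pi.single 0 1))) i
    rw [mulVec_smul, mulVec_mulVec, nonsing_inv_mul _ (isUnit_iff_ne_zero.2 hE'), one_mulVec] at h2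
    exact h2
  choose w hw using fun i => exists_aeval_basePoint (K i)
  refine ⟨c⁻¹ • Matrix.of fun i => w i.succ, fun y => ?_⟩
  -- The unit is the zeroth coordinate of the image; dividing by it changes the other coordinates,
  -- which are infinitesimal, only by c⁻¹.
  refine ⟨inl c + inr (w 0 ⬝ᵥ y), isUnit_of_fst_ne_zero (by simpa using hc), ?_⟩
  have hK' : evalDual K (basePoint y) = fun i => (inl c + inr (w 0 ⬝ᵥ y)) *
      basePoint ((c⁻¹ • Matrix.of fun i => w i.succ) *ᵥ y) i := by
    funext i
    rw [evalDual, hw, hK]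
    refine Fin.cases ?_ (fun j => ?_) i
    · simp [basePoint]
    · rw [basePoint, Fin.cons_succ, smul_mulVec]
      ext
      · simp
      · simp only [snd_add, snd_mul, snd_inl, snd_inr, fst_add, fst_inl, fst_inr, Pi.smul_apply]
        change 0 + w j.succ ⬝ᵥ y = (c + 0) * (c⁻¹ * (w j.succ ⬝ᵥ y)) + (0 + w 0 ⬝ᵥ y) * 0
        field_simp
        ring
  have hF : evalDual F (framePoint E y) = evalDual (linear E') (evalDual K (basePoint y)) := by
    rw [← evalDual_comp, ← comp_assoc, comp_linear, hmul, linear_one, ident_comp, evalDual_comp]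
    rfl
  rw [hF, hK', evalDual_mul (isHomogeneous_linear E'), pow_one]
  rfl

/-- In frame coordinates the zeroth entry is 1, which forces η = η'; the unit then cancels. So
differentials are well defined projectively. -/
lemma eq_of_framePoint {n : ℕ} {E : Matrix (Fin (n + 1)) (Fin (n + 1)) ℂ} (hE : E.det ≠ 0)
    {y y' : Fin n → ℂ} {η η' : DualNumber ℂ} (hη : IsUnit η)
    (h : ∀ i, η * framePoint E y i = η' * framePoint E y' i) : y = y' := by
  have hmul : E⁻¹ * E = 1 := nonsing_inv_mul _ (isUnit_iff_ne_zero.2 hE)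
  have h1 : ∀ (z : DualNumber ℂ) (v : Fin n → ℂ),
      evalDual (linear E⁻¹) (fun i => z * framePoint E v i) = fun i => z * basePoint v i := by
    intro z v
    rw [evalDual_mul (isHomogeneous_linear _), evalDual_linear_framePoint, hmul, framePoint_one,
      pow_one]
  have h2 := congrArg (evalDual (linear E⁻¹)) (funext h)
  rw [h1, h1] at h2
  have h0 := congrFun h2 0
  simp only [basePoint, Fin.cons_zero, mul_one] at h0
  subst h0
  funext j
  have h3 := hη.mul_left_cancel (congrFun h2 j.succ)
  simpa [basePoint] using congrArg snd h3

/-- An involution which exchanges two points has invertible differentials there. -/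
lemma IsInvolution.exists_jet {n d : ℕ} (hn : 1 ≤ n) {I : Forms n ℂ} (hI : IsInvolution d I)
    {E E' : Matrix (Fin (n + 1)) (Fin (n + 1)) ℂ} (hE : E.det ≠ 0) (hE' : E'.det ≠ 0)
    {c c' : ℂ} (hc : c ≠ 0) (hc' : c' ≠ 0)
    (h : ∀ i, eval (E *ᵥ Pi.single 0 1) (I i) = c * (E' *ᵥ Pi.single 0 1) i)
    (h' : ∀ i, eval (E' *ᵥ Pi.single 0 1) (I i) = c' * (E *ᵥ Pi.single 0 1) i) :
    ∃ T, T.det ≠ 0 ∧ Jet I E E' T := by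
  obtain ⟨T, hT⟩ := Cremona.exists_jet hE' hc h
  obtain ⟨T', hT'⟩ := Cremona.exists_jet hE hc' h'
  obtain ⟨φ, -, hφ⟩ := (sameMap_ident_iff hn _).1 hI.square
  -- T'T is the differential of I∘I, which is x up to a factor.
  have hone : T' * T = 1 := by
    apply Matrix.ext_of_mulVec_single
    intro j
    rw [one_mulVec]
    obtain ⟨η, hη, h1⟩ := (hT'.comp hI.homogeneous hT) (Pi.single j 1)
    refine eq_of_framePoint (η' := aeval (framePoint E (Pi.single j 1)) φ) hE hη fun i => ?_
    rw [← congrFun h1 i, evalDual, hφ, map_mul, aeval_X]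
  refine ⟨T, fun h0 => ?_, hT⟩
  have := congrArg Matrix.det hone
  rw [det_mul, h0, mul_zero, det_one] at this
  exact zero_ne_one this

/-- The frame at the point `[1 : … : 1]` which is the translate of the standard frame at
`[1 : 0 : … : 0]`. -/
def translation (n : ℕ) : Matrix (Fin (n + 1)) (Fin (n + 1)) ℂ :=
  Matrix.of fun i j => if j = 0 ∨ i = j then 1 else 0

lemma framePoint_translation {n : ℕ} (y : Fin n → ℂ) :
    framePoint (translation n) y = Fin.cons 1 fun i => 1 + inr (y i) := by
  funext i
  rw [framePoint, evalDual, linear, map_sum, Fin.sum_univ_succ]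
  refine Fin.cases ?_ (fun j => ?_) i
  · simp [translation, basePoint]
    exact Finset.sum_eq_zero fun j _ => by simp [Fin.ext_iff]
  · rw [Finset.sum_eq_single j]
    · simp [translation, basePoint]
    · intro k _ hk
      simp [translation, hk.symm]
    · simp

lemma det_translation (n : ℕ) : (translation n).det = 1 := by
  have : (translation n).IsLowerTriangular := by
    intro i j hij
    simp only [translation, Matrix.of_apply]
    rw [if_neg]
    rintro (rfl | rfl)
    · exact Fin.not_lt_zero _ (OrderDual.toDual_lt_toDual.1 hij)
    · exact lt_irrefl _ hij
  rw [Matrix.det_of_isLowerTriangular _ this]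
  simp [translation]

end Cremona

/-! ### Prescribing differentials at the two base points. -/

namespace Cremona

open MvPolynomial Matrix TrivSqZeroExt

/-- The pair `p` of mutually inverse transformations fixes `[1 : 0 : … : 0]` with trivial
differential, and the differential of the first one at the fixed point `[1 : … : 1]` is `T`. -/
def ShearJet {n : ℕ} (p : Forms n ℂ × Forms n ℂ) (T : Matrix (Fin n) (Fin n) ℂ) : Prop :=
  Jet p.1 1 1 1 ∧ Jet p.2 1 1 1 ∧ Jet p.1 (translation n) (translation n) T ∧
    Jet p.2 (translation n) (translation n) T⁻¹

lemma inr_sq (a : ℂ) : (inr a : DualNumber ℂ) ^ 2 = 0 := by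
  rw [pow_two, inr_mul_inr]

/-- The cubic form of a shear which fixes both base points, with trivial differential at the
first one. -/
noncomputable def shearCubic {n : ℕ} (j : Fin n) : MvPolynomial (Fin (n + 1)) ℂ :=
  X j.succ ^ 2 * (X j.succ - X 0)

lemma evalDual_shear {n : ℕ} (i : Fin (n + 1)) (k : ℕ) (φ : MvPolynomial (Fin (n + 1)) ℂ)
    (z : Fin (n + 1) → DualNumber ℂ) (hz : z 0 = 1) :
    evalDual (shear i k φ) z = fun l => z l + if l = i then aeval z φ else 0 := by
  funext l
  rw [evalDual, shear, map_add, map_mul, map_pow, aeval_X, aeval_X, hz, one_pow, one_mul]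
  split_ifs <;> simp

/-- The cubic contains x_j², and x_j is infinitesimal along tangent vectors at this point. -/
lemma jet_shear_base {n : ℕ} (i j : Fin n) (c : ℂ) :
    Jet (shear i.succ 2 (C c * shearCubic j)) 1 1 1 := by
  intro y
  refine ⟨1, isUnit_one, ?_⟩
  rw [framePoint_one, one_mulVec, framePoint_one, evalDual_shear _ _ _ _ (by simp [basePoint])]
  funext l
  have h : aeval (basePoint y) (shearCubic j) = 0 := by
    simp only [shearCubic, map_mul, map_pow, aeval_X, basePoint, Fin.cons_succ, inr_sq, zero_mul]
  rw [map_mul, h]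
  simp

/-- t²(t − 1) vanishes at t = 1 with derivative 1, so the shear adds c y_j to y_i. -/
lemma jet_shear_translation {n : ℕ} (i j : Fin n) (c : ℂ) :
    Jet (shear i.succ 2 (C c * shearCubic j)) (translation n) (translation n)
      (transvection i j c) := by
  intro y
  refine ⟨1, isUnit_one, ?_⟩
  rw [framePoint_translation, framePoint_translation, evalDual_shear _ _ _ _ (by simp)]
  have h : aeval (Fin.cons 1 fun i => 1 + inr (y i) : Fin (n + 1) → DualNumber ℂ) (shearCubic j) =
      inr (y j) := by
    simp only [shearCubic, map_mul, map_sub, map_pow, aeval_X, Fin.cons_succ, Fin.cons_zero]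
    linear_combination (2 + inr (y j) : DualNumber ℂ) * inr_sq (y j)
  rw [map_mul, h]
  funext l
  refine Fin.cases ?_ (fun l => ?_) l
  · simp [(Fin.succ_ne_zero _).symm]
  · have hT : (transvection i j c *ᵥ y) l = y l + if l = i then c * y j else 0 := by
      rw [transvection, add_mulVec, one_mulVec, Pi.add_apply, single_mulVec, Function.update_apply]
      rfl
    rw [Fin.cons_succ, Fin.cons_succ, hT, one_mul]
    by_cases hl : l = i
    · rw [if_pos (congrArg Fin.succ hl), if_pos hl, aeval_C, TrivSqZeroExt.algebraMap_eq_inl]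
      ext <;> simp [mul_comm]
    · rw [if_neg fun h => hl (Fin.succ_injective _ h), if_neg hl, add_zero, add_zero]

lemma bind_shearCubic {n : ℕ} {i j : Fin n} (hij : i ≠ j) (c : ℂ) :
    bind₁ (shear i.succ 2 (C c * shearCubic j)) (shearCubic j) =
      X 0 ^ (2 * (2 + 1)) * shearCubic j := by
  have h1 : shear i.succ 2 (C c * shearCubic j) j.succ = X 0 ^ 2 * X j.succ := by
    rw [shear, if_neg (by simpa using hij.symm), add_zero]
  have h2 : shear i.succ 2 (C c * shearCubic j) 0 = X 0 ^ 2 * X 0 := by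
    rw [shear, if_neg (Fin.succ_ne_zero _).symm, add_zero]
  have h3 : ∀ F : Forms n ℂ, bind₁ F (shearCubic j) = F j.succ ^ 2 * (F j.succ - F 0) := by
    intro F
    simp [shearCubic]
  rw [h3, h1, h2, shearCubic]
  ring

/-- An algebraic family of transformations which fix two points with trivial differential at the
first one and arbitrary differential of determinant one at the second one. -/
theorem exists_parametrized_shearJet {n : ℕ} (hn : 1 ≤ n) :
    ∃ 𝒯 : Set (Forms n ℂ × Forms n ℂ), Parametrized 𝒯 ∧
      ∀ T : Matrix (Fin n) (Fin n) ℂ, T.det = 1 → ∃ p ∈ 𝒯, ShearJet p T := by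
  -- Bounded generation is applied here to the n × n differentials at the second base point.
  refine special_linear_bounded_induction
    (q := fun U => ∃ 𝒯 : Set (Forms n ℂ × Forms n ℂ), Parametrized 𝒯 ∧
      ∀ T ∈ U, ∃ p ∈ 𝒯, ShearJet p T) ?_ ?_ ?_ ?_
  · rintro U V hUV ⟨𝒯, h, hV⟩
    exact ⟨𝒯, h, fun T hT => hV T (hUV hT)⟩
  · refine ⟨_, parametrized_ident n, ?_⟩
    rintro T rfl
    have h : ∀ E, Jet (ident n) E E 1 := fun E => by
      have := jet_linear (one_mul E)
      rwa [linear_one] at this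
    exact ⟨_, rfl, h _, h _, h _, by rw [inv_one]; exact h _⟩
  · rintro U V ⟨𝒯, h, hU⟩ ⟨𝒯', h', hV⟩
    refine ⟨_, h.comp hn h', ?_⟩
    rintro _ ⟨T, hT, T', hT', rfl⟩
    obtain ⟨p, hp, p1, p2, p3, p4⟩ := hU T hT
    obtain ⟨p', hp', p1', p2', p3', p4'⟩ := hV T' hT'
    obtain ⟨a, b, hab⟩ := h.inversePair hp
    obtain ⟨a', b', hab'⟩ := h'.inversePair hp'
    refine ⟨_, ⟨p, hp, p', hp', rfl⟩, ?_, ?_, ?_, ?_⟩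
    · simpa using p1.comp hab.1 p1'
    · simpa using p2'.comp hab'.2 p2
    · exact p3.comp hab.1 p3'
    · rw [Matrix.mul_inv_rev]
      exact p4'.comp hab'.2 p4
  · intro i j hij
    refine ⟨_, parametrized_shear (i := i.succ) (k := 2) (φ := shearCubic j)
      (Or.inl (Fin.succ_ne_zero i)) ?_ (bind_shearCubic hij), ?_⟩
    · exact (isHomogeneous_X_pow _ 2).mul ((isHomogeneous_X _ _).sub (isHomogeneous_X _ _))
    · rintro _ ⟨c, rfl⟩
      refine ⟨_, ⟨c, rfl⟩, jet_shear_base i j c, jet_shear_base i j (-c),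
        jet_shear_translation i j c, ?_⟩
      rw [inv_transvection hij]
      exact jet_shear_translation i j (-c)

/-- The scaling of the base point `[1 : 0 : … : 0]` which fixes the vector `(1, …, 1)`. -/
noncomputable def scaling {n : ℕ} (o : Fin n) (κ : ℂ) : Matrix (Fin (n + 1)) (Fin (n + 1)) ℂ :=
  1 + vecMulVec (Pi.single 0 1) ((κ - 1) • (Pi.single 0 1 - Pi.single o.succ 1))

lemma det_scaling {n : ℕ} (o : Fin n) (κ : ℂ) : (scaling o κ).det = κ := by
  rw [scaling, vecMulVec_eq Unit, det_one_add_replicateCol_mul_replicateRow]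
  simp

lemma evalDual_scaling {n : ℕ} (o : Fin n) (κ : ℂ) (z : Fin (n + 1) → DualNumber ℂ) :
    evalDual (linear (scaling o κ)) z =
      fun i => z i + if i = 0 then (κ - 1) • (z 0 - z o.succ) else 0 := by
  have h : ∀ M : Matrix (Fin (n + 1)) (Fin (n + 1)) ℂ,
      evalDual (linear M) z = fun i => ∑ j, M i j • z j := by
    intro M
    funext i
    simp [evalDual, linear, Algebra.smul_def]
  rw [h]
  funext i
  simp only [scaling, Matrix.add_apply, add_smul, Finset.sum_add_distrib, Matrix.one_apply,
    ite_smul, one_smul, zero_smul, Finset.sum_ite_eq, Finset.mem_univ, if_true, vecMulVec_apply]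
  congr 1
  split_ifs with hi
  · subst hi
    simp only [Pi.single_eq_same, one_mul, Pi.smul_apply, Pi.sub_apply, smul_eq_mul, mul_smul,
      ← Finset.smul_sum, sub_smul, Finset.sum_sub_distrib]
    simp [Pi.single_apply]
  · simp [hi]

/-- The scaling multiplies e_0 by κ and keeps the other coordinates, so normalizing the zeroth
coordinate divides tangent vectors by κ; κ compensates for this. -/
lemma jet_scaling_base {n : ℕ} (o : Fin n) {κ : ℂ} (hκ : κ ≠ 0) :
    Jet (ident n) 1 (scaling o κ) (κ • 1) := by
  intro y
  refine ⟨inl κ⁻¹ + inr (κ⁻¹ * (κ - 1) * y o), isUnit_of_fst_ne_zero (by simpa using hκ), ?_⟩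
  rw [evalDual_ident, framePoint_one, framePoint, evalDual_scaling]
  funext i
  refine Fin.cases ?_ (fun j => ?_) i
  · simp only [basePoint, Fin.cons_zero, Fin.cons_succ, if_true, smul_mulVec, one_mulVec,
      Pi.smul_apply]
    ext
    · simp; field_simp
    · simp; field_simp; ring
  · simp only [basePoint, Fin.cons_succ, if_neg (Fin.succ_ne_zero j), smul_mulVec, one_mulVec,
      Pi.smul_apply, add_zero]
    ext
    · simp
    · simp; field_simp

/-- The differential of `scaling` at `[1 : … : 1]`. -/
noncomputable def scalingDifferential {n : ℕ} (o : Fin n) (κ : ℂ) : Matrix (Fin n) (Fin n) ℂ :=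
  1 + vecMulVec (fun _ => 1) ((κ - 1) • Pi.single o 1)

lemma det_scalingDifferential {n : ℕ} (o : Fin n) (κ : ℂ) :
    (scalingDifferential o κ).det = κ := by
  rw [scalingDifferential, vecMulVec_eq Unit, det_one_add_replicateCol_mul_replicateRow]
  simp [dotProduct, Pi.single_apply]

/-- The zeroth coordinate becomes 1 − (κ − 1)ε y_o, and normalizing it adds (κ − 1) y_o to every
other one. This determinant κ and the κ^n at the other base point give κ^(n+1). -/
lemma jet_scaling_translation {n : ℕ} (o : Fin n) (κ : ℂ) :
    Jet (ident n) (scaling o κ * translation n) (translation n) (scalingDifferential o κ) := by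
  intro y
  refine ⟨inl 1 + inr (-((κ - 1) * y o)), isUnit_of_fst_ne_zero (by simp), ?_⟩
  rw [evalDual_ident, ← evalDual_linear_framePoint, framePoint_translation, evalDual_scaling,
    framePoint_translation]
  have hd : ∀ j, (scalingDifferential o κ *ᵥ y) j = y j + (κ - 1) * y o := by
    intro j
    rw [scalingDifferential, add_mulVec, one_mulVec, Pi.add_apply, vecMulVec_mulVec]
    simp
  funext i
  refine Fin.cases ?_ (fun j => ?_) i
  · simp only [Fin.cons_zero, Fin.cons_succ, if_true]
    ext <;> simp
  · simp only [Fin.cons_succ, if_neg (Fin.succ_ne_zero j), add_zero, hd]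
    ext <;> simp

/-- Any two pairs of independent vectors are related by an invertible matrix. -/
lemma exists_matrix_of_linearIndependent {m : ℕ} {u v u' v' : Fin m → ℂ}
    (h : LinearIndependent ℂ ![u, v]) (h' : LinearIndependent ℂ ![u', v']) :
    ∃ M : Matrix (Fin m) (Fin m) ℂ, M.det ≠ 0 ∧ M *ᵥ u = u' ∧ M *ᵥ v = v' := by
  let b := Module.Basis.sumExtend h
  let b' := Module.Basis.sumExtend h'
  have := Module.Finite.finite_basis b
  have := Module.Finite.finite_basis b'
  have : Finite (Module.Basis.sumExtendIndex h) :=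
    Finite.of_injective (Sum.inr : _ → Fin 2 ⊕ _) Sum.inr_injective
  have : Finite (Module.Basis.sumExtendIndex h') :=
    Finite.of_injective (Sum.inr : _ → Fin 2 ⊕ _) Sum.inr_injective
  have hcard : Nat.card (Module.Basis.sumExtendIndex h) =
      Nat.card (Module.Basis.sumExtendIndex h') := by
    have h1 := Module.finrank_eq_nat_card_basis b
    have h2 := Module.finrank_eq_nat_card_basis b'
    rw [h1, Nat.card_sum, Nat.card_sum] at h2
    omega
  obtain ⟨e⟩ := Finite.card_eq.1 hcard
  let f := b.equiv b' (Equiv.sumCongr (Equiv.refl _) e)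
  have hb : ∀ i, b (Sum.inl i) = ![u, v] i := fun i => by
    simp only [b]
    rw [Module.Basis.sumExtend, Module.Basis.reindex_apply, Module.Basis.extend_apply_self]
    rfl
  have hb' : ∀ i, b' (Sum.inl i) = ![u', v'] i := fun i => by
    simp only [b']
    rw [Module.Basis.sumExtend, Module.Basis.reindex_apply, Module.Basis.extend_apply_self]
    rfl
  have hf : ∀ i, f (![u, v] i) = ![u', v'] i := by
    intro i
    rw [← hb, Module.Basis.equiv_apply, Equiv.sumCongr_apply, Sum.map_inl, hb']
    rfl
  refine ⟨LinearMap.toMatrix' f.toLinearMap, ?_, ?_, ?_⟩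
  · rw [LinearMap.det_toMatrix']
    exact (LinearEquiv.isUnit_det' f).ne_zero
  · rw [LinearMap.toMatrix'_mulVec]
    exact hf 0
  · rw [LinearMap.toMatrix'_mulVec]
    exact hf 1

end Cremona

/-! ### Leading monomials at a fixed point. -/

namespace Cremona

open MvPolynomial Matrix TrivSqZeroExt

/-- Variable 0 is the greatest one in this order, so its exponent decides first. -/
lemma degree_lex_eq {n : ℕ} {f : MvPolynomial (Fin (n + 1)) ℂ} {β : Fin (n + 1) →₀ ℕ}
    (hβ : coeff β f ≠ 0) (h : ∀ γ, coeff γ f ≠ 0 → γ ≠ β → γ 0 < β 0) :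
    (MonomialOrder.lex : MonomialOrder (Fin (n + 1))).degree f = β := by
  set mo : MonomialOrder (Fin (n + 1)) := MonomialOrder.lex
  by_contra hne
  have h1 := mo.le_degree (mem_support_iff.2 hβ)
  have hf : f ≠ 0 := fun h0 => hβ (by rw [h0, coeff_zero])
  have h2 := h _ (mem_support_iff.1 (mo.degree_mem_support hf)) hne
  have h3 : toLex (mo.degree f) < toLex β :=
    Finsupp.Lex.lt_iff.2 ⟨0, fun j hj => absurd hj (Fin.not_lt_zero j), h2⟩
  exact absurd h1 (not_le.2 (MonomialOrder.lex_lt_iff.2 h3))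

lemma eval_single_of_homogeneous {n d : ℕ} {f : MvPolynomial (Fin (n + 1)) ℂ}
    (hf : f.IsHomogeneous d) : eval (Pi.single 0 1) f = coeff (Finsupp.single 0 d) f := by
  rw [eval_eq', Finset.sum_eq_single (Finsupp.single 0 d)]
  · rw [Finset.prod_eq_one, mul_one]
    intro i _
    by_cases hi : i = 0
    · simp [hi]
    · simp [hi]
  · intro β hβ hne
    obtain ⟨i, hi, hi'⟩ : ∃ i, i ≠ 0 ∧ β i ≠ 0 := by
      by_contra! h
      refine hne ?_
      have h0 : β = Finsupp.single 0 (β 0) := by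
        ext i
        by_cases hi : i = 0
        · simp [hi]
        · simp [h i hi, Ne.symm hi]
      have h1 : β.degree = d := by
        by_contra h1
        exact mem_support_iff.1 hβ (hf.coeff_eq_zero h1)
      rw [h0, Finsupp.degree_single] at h1
      rw [h0, h1]
    rw [Finset.prod_eq_zero (Finset.mem_univ i), mul_zero]
    rw [Pi.single_eq_of_ne hi, zero_pow hi']
  · intro h
    rw [notMem_support_iff.1 h, zero_mul]

lemma exists_eq_single_add_single {n d : ℕ} {γ : Fin (n + 1) →₀ ℕ} (h : γ.degree = d + 1)
    (h0 : d ≤ γ 0) : ∃ k, γ = Finsupp.single 0 d + Finsupp.single k 1 := by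
  obtain ⟨δ, rfl⟩ : ∃ δ, γ = Finsupp.single 0 d + δ :=
    ⟨γ - Finsupp.single 0 d, (add_tsub_cancel_of_le (Finsupp.single_le_iff.2 h0)).symm⟩
  rw [map_add, Finsupp.degree_single, add_right_inj] at h
  obtain ⟨k, hk⟩ : ∃ k, δ k ≠ 0 := by
    by_contra! hδ
    rw [show δ = 0 from Finsupp.ext hδ, map_zero] at h
    exact one_ne_zero h.symm
  obtain ⟨ε, rfl⟩ : ∃ ε, δ = Finsupp.single k 1 + ε :=
    ⟨δ - Finsupp.single k 1, (add_tsub_cancel_of_le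
      (Finsupp.single_le_iff.2 (Nat.one_le_iff_ne_zero.2 hk))).symm⟩
  rw [map_add, Finsupp.degree_single, Nat.add_eq_left, Finsupp.degree_eq_zero_iff] at h
  exact ⟨k, by rw [h, add_zero]⟩

/-- The leading monomials, for the lexicographic order, of a map that fixes the base point with
a diagonal differential. -/
lemma Jet.exists_degree_lex {n d : ℕ} (hn : 1 ≤ n) {F : Forms n ℂ}
    (hF : ∀ i, (F i).IsHomogeneous d) {l : Fin n → ℂ} (hl : ∀ i, l i ≠ 0)
    (h : Jet F 1 1 (diagonal l)) : ∃ (c : ℂ) (e : ℕ), c ≠ 0 ∧ ∀ i,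
      (MonomialOrder.lex : MonomialOrder (Fin (n + 1))).degree (F i) =
        Finsupp.single 0 e + Finsupp.single i 1 ∧
      (MonomialOrder.lex : MonomialOrder (Fin (n + 1))).leadingCoeff (F i) =
        c * (Fin.cons 1 l : Fin (n + 1) → ℂ) i := by
  have key : ∀ y, ∃ η : DualNumber ℂ, IsUnit η ∧ ∀ i, inl (eval (Pi.single 0 1) (F i)) +
      inr ((fun j : Fin n => eval (Pi.single 0 1) (pderiv j.succ (F i))) ⬝ᵥ y) =
      η * basePoint (fun j => l j * y j) i := by
    intro y
    obtain ⟨η, hη, hy⟩ := h y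
    refine ⟨η, hη, fun i => ?_⟩
    rw [← aeval_basePoint]
    have := congrFun hy i
    rw [framePoint_one, framePoint_one] at this
    rw [evalDual] at this
    rw [this]
    congr 2
    funext j
    rw [mulVec_diagonal]
  set c := eval (Pi.single 0 1) (F 0) with hc
  have hη0 : ∀ η : DualNumber ℂ, IsUnit η → fst η ≠ 0 := fun η hη =>
    (hη.map (fstHom ℂ ℂ ℂ)).ne_zero
  have hc0 : c ≠ 0 := by
    obtain ⟨η, hη, hy⟩ := key 0
    have := congrArg fst (hy 0)
    simp [basePoint] at this
    rw [hc, this]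
    exact hη0 η hη
  have h0 : ∀ j : Fin n, eval (Pi.single 0 1) (F j.succ) = 0 := by
    intro j
    obtain ⟨η, hη, hy⟩ := key 0
    have := congrArg fst (hy j.succ)
    simpa [basePoint] using this
  have h1 : ∀ j k : Fin n, eval (Pi.single 0 1) (pderiv k.succ (F j.succ)) =
      if k = j then c * l j else 0 := by
    intro j k
    obtain ⟨η, hη, hy⟩ := key (Pi.single k 1)
    have hfst := congrArg fst (hy 0)
    simp [basePoint, ← hc] at hfst
    have := congrArg snd (hy j.succ)
    simp [basePoint] at this
    rw [this, ← hfst, Pi.single_apply]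
    by_cases hjk : j = k
    · simp [hjk, mul_comm]
    · simp [hjk, Ne.symm hjk]
  obtain ⟨e, rfl⟩ : ∃ e, d = e + 1 := by
    refine Nat.exists_eq_succ_of_ne_zero ?_
    rintro rfl
    have := h1 ⟨0, hn⟩ ⟨0, hn⟩
    rw [totalDegree_eq_zero_iff_eq_C.1 (Nat.le_zero.1 (hF _).totalDegree_le), pderiv_C, map_zero,
      if_pos rfl] at this
    exact mul_ne_zero hc0 (hl _) this.symm
  -- The value and first derivatives at e_0 are the coefficients of x_0^d and x_0^(d−1) x_k, the
  -- only monomials that can exceed or tie with the claimed leading ones in the exponent of x_0.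
  have c0 : ∀ i, coeff (Finsupp.single 0 e + Finsupp.single 0 1) (F i) =
      eval (Pi.single 0 1) (F i) := fun i => by
    rw [eval_single_of_homogeneous (hF i), ← Finsupp.single_add]
  have c1 : ∀ j k : Fin n, coeff (Finsupp.single 0 e + Finsupp.single k.succ 1) (F j.succ) =
      if k = j then c * l j else 0 := fun j k => by
    rw [← h1, eval_single_of_homogeneous (hF _).pderiv, coeff_pderiv]
    simp
  have hcoeff : ∀ i, coeff (Finsupp.single 0 e + Finsupp.single i 1) (F i) =
      c * (Fin.cons 1 l : Fin (n + 1) → ℂ) i := by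
    intro i
    refine Fin.cases ?_ (fun j => ?_) i
    · rw [c0, Fin.cons_zero, mul_one]
    · rw [c1, if_pos rfl, Fin.cons_succ]
  have hdeg : ∀ i, (MonomialOrder.lex : MonomialOrder (Fin (n + 1))).degree (F i) =
        Finsupp.single 0 e + Finsupp.single i 1 := by
    intro i
    refine degree_lex_eq ?_ fun γ hγ hne => ?_
    · rw [hcoeff]
      refine mul_ne_zero hc0 ?_
      refine Fin.cases ?_ (fun j => ?_) i
      · simp
      · simpa using hl j
    · by_contra hlt
      rw [not_lt, Finsupp.add_apply, Finsupp.single_eq_same] at hlt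
      have hγd : γ.degree = e + 1 := by
        by_contra h2
        exact hγ ((hF i).coeff_eq_zero h2)
      obtain ⟨k, rfl⟩ := exists_eq_single_add_single hγd (by omega)
      revert hγ hne hlt
      refine Fin.cases ?_ (fun j => ?_) i <;> refine Fin.cases ?_ (fun k => ?_) k
      · simp
      · simp
      · intro hγ
        exact absurd ((c0 _).trans (h0 j)) hγ
      · intro hγ hne
        rw [c1] at hγ
        by_cases hkj : k = j
        · exact absurd (by rw [hkj]) hne
        · exact absurd (if_neg hkj) hγ
  exact ⟨c, e, hc0, fun i => ⟨hdeg i, by rw [MonomialOrder.leadingCoeff, hdeg, hcoeff]⟩⟩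

end Cremona

/-! ### Moving the involutions to the base points. -/

namespace Cremona

open MvPolynomial Matrix TrivSqZeroExt

section NormalForms

variable {n d : ℕ} {I : Forms n ℂ}

/-- An involution moves some point `r` to an independent point, which it maps back to `r`. -/
lemma IsInvolution.exists_independent_image (hn : 1 ≤ n) (hI : IsInvolution d I) :
    ∃ (r : Fin (n + 1) → ℂ) (c : ℂ), c ≠ 0 ∧
      LinearIndependent ℂ ![r, fun i => eval r (I i)] ∧
      ∀ i, eval (fun j => eval r (I j)) (I i) = c * r i := by
  obtain ⟨φ, hφ, h⟩ := (sameMap_ident_iff hn _).1 hI.square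
  obtain ⟨i, j, hij⟩ : ∃ i j, I i * X j - I j * X i ≠ 0 := by
    by_contra! h0
    refine hI.nontrivial ⟨fun h1 => hI.ne_zero hn 0 (congrFun h1 0),
      fun h1 => X_ne_zero (R := ℂ) (0 : Fin (n + 1)) (congrFun h1 0), fun i j => ?_⟩
    exact sub_eq_zero.1 (h0 i j)
  -- The factor φ ensures that I maps I(r) back to r; the minor ensures that r and I(r) are
  -- independent.
  obtain ⟨r, hr⟩ : ∃ r, eval r (φ * (I i * X j - I j * X i)) ≠ 0 := by
    by_contra! h0
    exact mul_ne_zero hφ hij (MvPolynomial.funext fun r => by rw [h0, map_zero])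
  rw [map_mul] at hr
  refine ⟨r, eval r φ, left_ne_zero_of_mul hr, ?_, fun k => ?_⟩
  · have h1 : eval r (I i) * r j - eval r (I j) * r i ≠ 0 := by
      simpa using right_ne_zero_of_mul hr
    rw [LinearIndependent.pair_iff]
    intro s t hst
    have hi : s * r i + t * eval r (I i) = 0 := by simpa using congrFun hst i
    have hj : s * r j + t * eval r (I j) = 0 := by simpa using congrFun hst j
    constructor
    · refine (mul_eq_zero.1 (?_ : s * (eval r (I i) * r j - eval r (I j) * r i) = 0)).resolve_right h1
      linear_combination eval r (I i) * hj - eval r (I j) * hi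
    · refine (mul_eq_zero.1 (?_ : t * (eval r (I i) * r j - eval r (I j) * r i) = 0)).resolve_right h1
      linear_combination r j * hi - r i * hj
  · have := congrArg (eval r) (h k)
    rw [map_mul, eval_X, comp, ← aeval_eq_eval, aeval_bind₁] at this
    rw [aeval_eq_eval] at this
    exact this

lemma translation_mulVec (n : ℕ) : translation n *ᵥ Pi.single 0 1 = fun _ => 1 := by
  funext i
  refine Fin.cases ?_ (fun j => ?_) i <;> simp [translation]

lemma linearIndependent_single_one (hn : 1 ≤ n) :
    LinearIndependent ℂ ![(Pi.single 0 1 : Fin (n + 1) → ℂ), fun _ => 1] := by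
  rw [LinearIndependent.pair_iff]
  intro s t hst
  have h0 : s + t = 0 := by simpa using congrFun hst 0
  have h1 : t = 0 := by simpa using congrFun hst (Fin.succ ⟨0, hn⟩)
  exact ⟨by rw [← h0, h1, add_zero], h1⟩

lemma exists_smul_det_eq_one {M : Matrix (Fin (n + 1)) (Fin (n + 1)) ℂ} (hM : M.det ≠ 0) :
    ∃ s : ℂ, s ≠ 0 ∧ (s • M).det = 1 := by
  obtain ⟨s, hs⟩ := IsAlgClosed.exists_pow_nat_eq (M.det)⁻¹ n.succ_pos
  refine ⟨s, ?_, ?_⟩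
  · rintro rfl
    rw [zero_pow n.succ_ne_zero] at hs
    exact inv_ne_zero hM hs.symm
  · rw [det_smul, Fintype.card_fin, hs, inv_mul_cancel₀ hM]

lemma Jet.smul_frames (hd : ∀ i, (I i).IsHomogeneous d)
    {E E' : Matrix (Fin (n + 1)) (Fin (n + 1)) ℂ} {T : Matrix (Fin n) (Fin n) ℂ}
    (h : Jet I E E' T) {s : ℂ} (hs : s ≠ 0) : Jet I (s • E) (s • E') T := by
  have := h.change hd (jet_ident_smul E hs) (jet_ident_smul' E' hs)
  rwa [mul_one, one_mul] at this

lemma IsInvolution.exists_jet_to_translation (hn : 1 ≤ n) (hI : IsInvolution d I) :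
    ∃ M δ, M.det = 1 ∧ δ.det ≠ 0 ∧ Jet I M (M * translation n) δ := by
  obtain ⟨r, c, hc, hr, h⟩ := hI.exists_independent_image hn
  obtain ⟨M, hM, h1, h2⟩ := exists_matrix_of_linearIndependent (linearIndependent_single_one hn) hr
  have hB : (M * translation n) *ᵥ Pi.single 0 1 = fun i => eval r (I i) := by
    rw [← mulVec_mulVec, translation_mulVec, h2]
  obtain ⟨δ, hδ, hJ⟩ := hI.exists_jet hn (E := M) (E' := M * translation n) hM
    (by rwa [det_mul, det_translation, mul_one]) one_ne_zero hc
    (fun i => by rw [h1, hB, one_mul]) (fun i => by rw [h1, hB, h])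
  obtain ⟨s, hs, hdet⟩ := exists_smul_det_eq_one hM
  refine ⟨s • M, δ, hdet, hδ, ?_⟩
  rw [smul_mul]
  exact hJ.smul_frames hI.homogeneous hs

/-- M first sends e_0 to I(r) and (1, …, 1) to r. Inserting the scaling changes the frames at both
points but neither point, and multiplies the determinant of the differential by κ^(n+1), while M can
be renormalized to determinant one. -/
lemma IsInvolution.exists_jet_from_translation (hn : 1 ≤ n) (hI : IsInvolution d I) :
    ∃ c : ℂ, c ≠ 0 ∧ ∀ κ : ℂ, κ ≠ 0 → ∃ M δ, M.det = 1 ∧ δ.det = κ ^ (n + 1) * c ∧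
      Jet I (M * translation n) M δ := by
  obtain ⟨r, c, hc, hr, h⟩ := hI.exists_independent_image hn
  obtain ⟨M, hM, h1, h2⟩ := exists_matrix_of_linearIndependent (linearIndependent_single_one hn)
    (LinearIndependent.pair_symm_iff.1 hr)
  have hB : (M * translation n) *ᵥ Pi.single 0 1 = r := by
    rw [← mulVec_mulVec, translation_mulVec, h2]
  obtain ⟨δ, hδ, hJ⟩ := hI.exists_jet hn (E := M * translation n) (E' := M)
    (by rwa [det_mul, det_translation, mul_one]) hM one_ne_zero hc
    (fun i => by rw [h1, hB, one_mul]) (fun i => by rw [h1, hB, h])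
  refine ⟨δ.det, hδ, fun κ hκ => ?_⟩
  let o : Fin n := ⟨0, hn⟩
  have hJ' := hJ.change hI.homogeneous ((jet_scaling_translation o κ).ident_mul M)
    ((jet_scaling_base o hκ).ident_mul M |> (mul_one M ▸ ·))
  obtain ⟨s, hs, hdet⟩ := exists_smul_det_eq_one (M := M * scaling o κ)
    (by rw [det_mul, det_scaling]; exact mul_ne_zero hM hκ)
  refine ⟨s • (M * scaling o κ), κ • 1 * (δ * scalingDifferential o κ), hdet, ?_, ?_⟩
  · rw [det_mul, det_mul, det_scalingDifferential, det_smul, det_one, Fintype.card_fin]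
    ring
  · rw [smul_mul, Matrix.mul_assoc]
    exact hJ'.smul_frames hI.homogeneous hs

end NormalForms

/-- A family of transformations in which the images of the two base points, and the
differentials there, can be prescribed. -/
lemma exists_parametrized_jet {n : ℕ} (hn : 1 ≤ n) :
    ∃ 𝒯 : Set (Forms n ℂ × Forms n ℂ), Parametrized 𝒯 ∧
      ∀ (M : Matrix (Fin (n + 1)) (Fin (n + 1)) ℂ) (T : Matrix (Fin n) (Fin n) ℂ),
        M.det = 1 → T.det = 1 → ∃ p ∈ 𝒯, Jet p.1 1 M 1 ∧ Jet p.2 M 1 1 ∧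
          Jet p.1 (translation n) (M * translation n) T ∧
          Jet p.2 (M * translation n) (translation n) T⁻¹ := by
  obtain ⟨𝒯, h𝒯, h⟩ := exists_parametrized_shearJet hn
  refine ⟨_, (parametrized_special_linear hn).comp hn h𝒯, fun M T hM hT => ?_⟩
  obtain ⟨p, hp, h1, h2, h3, h4⟩ := h T hT
  refine ⟨_, ⟨_, ⟨M, hM, rfl⟩, p, hp, rfl⟩, ?_⟩
  obtain ⟨a, b, hpair⟩ := h𝒯.inversePair hp
  have hMM : M⁻¹ * M = 1 := nonsing_inv_mul M (by rw [hM]; exact isUnit_one)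
  have hl := isHomogeneous_linear M
  refine ⟨?_, ?_, ?_, ?_⟩
  · simpa using (jet_linear (mul_one M)).comp hl h1
  · simpa using h2.comp hpair.homogeneous_inv (jet_linear hMM)
  · simpa using (jet_linear rfl).comp hl h3
  · have : M⁻¹ * (M * translation n) = translation n := by rw [← Matrix.mul_assoc, hMM, one_mul]
    simpa using h4.comp hpair.homogeneous_inv (jet_linear this)

/-- Suitable members of the family conjugate the involutions `I` and `J` to involutions whose
product fixes the base point with a prescribed differential. -/
lemma exists_conjugates_jet {n : ℕ} (hn : 1 ≤ n) {𝒯 : Set (Forms n ℂ × Forms n ℂ)}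
    (h𝒯 : Parametrized 𝒯)
    (h : ∀ (M : Matrix (Fin (n + 1)) (Fin (n + 1)) ℂ) (T : Matrix (Fin n) (Fin n) ℂ),
        M.det = 1 → T.det = 1 → ∃ p ∈ 𝒯, Jet p.1 1 M 1 ∧ Jet p.2 M 1 1 ∧
          Jet p.1 (translation n) (M * translation n) T ∧
          Jet p.2 (M * translation n) (translation n) T⁻¹)
    {d d' : ℕ} {I J : Forms n ℂ} (hI : IsInvolution d I) (hJ : IsInvolution d' J)
    {Λ : Matrix (Fin n) (Fin n) ℂ} (hΛ : Λ.det ≠ 0) : ∃ p ∈ 𝒯, ∃ q ∈ 𝒯,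
      Jet (comp (comp p.2 (comp I p.1)) (comp q.2 (comp J q.1))) 1 1 Λ := by
  obtain ⟨c, hc, hI'⟩ := hI.exists_jet_from_translation hn
  obtain ⟨M', δ', hM', hδ', hJ'⟩ := hJ.exists_jet_to_translation hn
  -- Chosen so that δ⁻¹ Λ δ'⁻¹ has determinant one and is thus available as a differential at the
  -- second base point.
  obtain ⟨κ, hκ⟩ := IsAlgClosed.exists_pow_nat_eq (Λ.det / (c * δ'.det)) n.succ_pos
  have hκ0 : κ ≠ 0 := by
    rintro rfl
    rw [zero_pow n.succ_ne_zero] at hκ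
    exact div_ne_zero hΛ (mul_ne_zero hc hδ') hκ.symm
  obtain ⟨M, δ, hM, hδ, hI''⟩ := hI' κ hκ0
  have hδΛ : δ.det = Λ.det / δ'.det := by
    rw [hδ, hκ]
    field_simp
  have hδ0 : δ.det ≠ 0 := hδΛ ▸ div_ne_zero hΛ hδ'
  obtain ⟨p, hp, -, hp2, hp3, -⟩ := h M (δ⁻¹ * Λ * δ'⁻¹) hM (by
    rw [det_mul, det_mul, det_nonsing_inv, det_nonsing_inv, Ring.inverse_eq_inv', hδΛ]
    field_simp)
  obtain ⟨q, hq, hq1, -, -, hq4⟩ := h M' 1 hM' det_one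
  obtain ⟨a, b, hpp⟩ := h𝒯.inversePair hp
  obtain ⟨a', b', hqq⟩ := h𝒯.inversePair hq
  refine ⟨p, hp, q, hq, ?_⟩
  have j1 := hp2.comp hpp.homogeneous_inv (hI''.comp hI.homogeneous hp3)
  have j2 := hq4.comp hqq.homogeneous_inv (hJ'.comp hJ.homogeneous hq1)
  have hm : 1 * (δ * (δ⁻¹ * Λ * δ'⁻¹)) * (1⁻¹ * (δ' * 1)) = Λ := by
    rw [inv_one, one_mul, one_mul, mul_one, Matrix.mul_assoc, Matrix.mul_assoc (δ⁻¹ * Λ),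
      nonsing_inv_mul _ (isUnit_iff_ne_zero.2 hδ'), mul_one, ← Matrix.mul_assoc,
      mul_nonsing_inv _ (isUnit_iff_ne_zero.2 hδ0), one_mul]
  rw [← hm]
  exact j1.comp (homogeneous_comp hpp.homogeneous_inv
    (homogeneous_comp hI.homogeneous hpp.homogeneous)) j2

end Cremona

/-! ### Very general conjugates have no invariants. -/

namespace Cremona

open MvPolynomial Matrix

/-- The single word K_o K_p suffices: its diagonal differential yields leading monomials to which
`eq_C_mul_of_invariant` applies. -/
lemma not_hasNontrivialInvariant_of_jet {n ν d : ℕ} (hn : 1 ≤ n) {K : Fin ν → Forms n ℂ}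
    {o p : Fin ν} (hd : ∀ i, (comp (K o) (K p) i).IsHomogeneous d)
    (h : Jet (comp (K o) (K p)) 1 1 (diagonal fun j : Fin n => multiplier (j + 1))) (m : ℕ) :
    ¬ HasNontrivialInvariant K m := by
  rintro ⟨P, Q, hP, hQ, hQ0, hPQ, hinv⟩
  have hw := (hinv [o, p]).2
  simp only [word, comp_ident] at hw
  obtain ⟨c, e, hc, hdeg⟩ := h.exists_degree_lex hn hd fun _ => multiplier_ne_zero _
  have hl : (Fin.cons 1 fun j : Fin n => multiplier (j + 1) : Fin (n + 1) → ℂ) =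
      fun i : Fin (n + 1) => multiplier i ^ 1 := by
    funext i
    refine Fin.cases ?_ (fun j => ?_) i <;> simp [multiplier]
  rw [hl] at hdeg
  exact hPQ (eq_C_mul_of_invariant MonomialOrder.lex (l := fun i => c * multiplier i ^ 1)
    (fun i => mul_ne_zero hc (pow_ne_zero _ (multiplier_ne_zero _))) (fun i => (hdeg i).1)
    (fun i => (hdeg i).2) (multiplier_independent hc one_ne_zero) hP hQ hQ0 hw)

lemma isInvolution_conjugated {n N ν a b : ℕ} (hn : 1 ≤ n)
    {G H : Forms n (MvPolynomial (Fin N) ℂ)} (hGH : IsBirationalFamily a b G H)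
    {d : Fin ν → ℕ} {I : Fin ν → Forms n ℂ} (hI : ∀ k, IsInvolution (d k) (I k))
    (s : Fin ν × Fin N → ℂ) (k : Fin ν) :
    IsInvolution (b * (d k * a)) (conjugated G H I s k) :=
  (hI k).conj hn (InversePair.of_member hGH _)

/-- The conjugates of the `I k` by the members of a family, with indeterminate parameters. -/
noncomputable def genericConjugated {n N ν : ℕ} (G H : Forms n (MvPolynomial (Fin N) ℂ))
    (I : Fin ν → Forms n ℂ) : Fin ν → Forms n (MvPolynomial (Fin ν × Fin N) ℂ) := fun k =>
  compOver (renameParameters (fun l => (k, l)) H)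
    (compOver (fun i => map C (I k i)) (renameParameters (fun l => (k, l)) G))

lemma map_genericConjugated {n N ν : ℕ} (G H : Forms n (MvPolynomial (Fin N) ℂ))
    (I : Fin ν → Forms n ℂ) (s : Fin ν × Fin N → ℂ) :
    (fun k i => map (eval s) (genericConjugated G H I k i)) = conjugated G H I s := by
  funext k
  have h : (fun i => map (eval s) (map C (I k i))) = I k := by
    funext i
    rw [MvPolynomial.map_map, show (eval s).comp C = RingHom.id ℂ from RingHom.ext fun a => eval_C a,
      MvPolynomial.map_id]
  simp only [genericConjugated]
  rw [map_compOver, map_compOver, map_renameParameters, map_renameParameters, h]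
  rfl

/-- For each m, some resultant of the generic conjugates is nonzero at `s₀`; these resultants are
the countably many polynomials to avoid. -/
lemma veryGeneral_conjugated {n N ν a b : ℕ} (hn : 1 ≤ n)
    {G H : Forms n (MvPolynomial (Fin N) ℂ)} (hGH : IsBirationalFamily a b G H)
    {d : Fin ν → ℕ} {I : Fin ν → Forms n ℂ} (hI : ∀ k, IsInvolution (d k) (I k))
    {s₀ : Fin ν × Fin N → ℂ}
    (h₀ : ∀ m, ¬ HasNontrivialInvariant (conjugated G H I s₀) m) :
    VeryGeneral fun s : Fin ν × Fin N → ℂ =>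
      ∀ m, ¬ HasNontrivialInvariant (conjugated G H I s) m := by
  have key : ∀ s m, HasNontrivialInvariant (conjugated G H I s) m ↔
      ∀ f ∈ resultants (plueckerRelations (DegExp (Fin (n + 1)) m) _ ∪
        invarianceEquations (genericConjugated G H I) m), eval s f = 0 := fun s m => by
    rw [hasNontrivialInvariant_iff hn (isInvolution_conjugated hn hGH hI s),
      ← map_genericConjugated, hasCommonInvariant_iff_resultants]
  have hex : ∀ m, ∃ f ∈ resultants (plueckerRelations (DegExp (Fin (n + 1)) m) _ ∪
      invarianceEquations (genericConjugated G H I) m), eval s₀ f ≠ 0 := by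
    intro m
    by_contra! hall
    exact h₀ m ((key s₀ m).2 hall)
  choose f hf hf0 using hex
  refine ⟨f, fun m h => hf0 m (by rw [h, map_zero]), fun s hs m h => hs m ?_⟩
  exact (key s m).1 h _ (hf m)

/-- There is a family of birational transformations such that, after conjugation by very general
members of the family, no involutions have a common non-trivial invariant. -/
theorem exists_family_veryGeneral_conjugated {n ν : ℕ} (hn : 1 ≤ n) (hν : 2 ≤ ν) :
    ∃ (N a b : ℕ) (G H : Forms n (MvPolynomial (Fin N) ℂ)), IsBirationalFamily a b G H ∧
      ∀ (d : Fin ν → ℕ) (I : Fin ν → Forms n ℂ), (∀ k, IsInvolution (d k) (I k)) →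
        (∀ s k, IsInvolution (b * (d k * a)) (conjugated G H I s k)) ∧
        VeryGeneral (fun s : Fin ν × Fin N → ℂ =>
          ∀ m, ¬ HasNontrivialInvariant (conjugated G H I s) m) := by
  obtain ⟨𝒯, h𝒯, hjet⟩ := exists_parametrized_jet hn
  obtain ⟨N, a, b, G, H, hGH, hmem⟩ := id h𝒯
  refine ⟨N, a, b, G, H, hGH, fun d I hI => ⟨isInvolution_conjugated hn hGH hI, ?_⟩⟩
  let o : Fin ν := ⟨0, by omega⟩
  let p : Fin ν := ⟨1, by omega⟩
  have hpo : p ≠ o := by simp [o, p]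
  obtain ⟨u, hu, v, hv, hJ⟩ := exists_conjugates_jet hn h𝒯 hjet (hI o) (hI p)
    (Λ := diagonal fun j : Fin n => multiplier (j + 1)) (by
      rw [det_diagonal]
      exact Finset.prod_ne_zero_iff.2 fun j _ => multiplier_ne_zero _)
  obtain ⟨t, ht, ht'⟩ := hmem u hu
  obtain ⟨t', hs, hs'⟩ := hmem v hv
  -- Only the generators o and p matter; the parameters of the others are arbitrary.
  let s₀ : Fin ν × Fin N → ℂ := fun x => if x.1 = o then t x.2 else t' x.2
  have ho : conjugated G H I s₀ o = comp u.2 (comp (I o) u.1) := by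
    simp only [conjugated, s₀, if_true, ht, ht']
  have hp : conjugated G H I s₀ p = comp v.2 (comp (I p) v.1) := by
    simp only [conjugated, s₀, if_neg hpo, hs, hs']
  have hinv := isInvolution_conjugated hn hGH hI s₀
  exact veryGeneral_conjugated hn hGH hI fun m =>
    not_hasNontrivialInvariant_of_jet hn (o := o) (p := p)
      (homogeneous_comp (hinv o).homogeneous (hinv p).homogeneous) (by rwa [ho, hp]) m

end Cremona

theorem mainTheorem5 (n ν : ℕ) (hn : 1 ≤ n) (hν : 2 ≤ ν) :
    -- for each `m`, having no non-trivial invariant of degree at most `m` is an open condition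
    (∀ m : ℕ, Cremona.IsZariskiClosed
      (fun I : Fin ν → Cremona.Forms n ℂ => Cremona.HasNontrivialInvariant I m)) ∧
    -- there is a family of birational transformations, containing the identity, such that for
    -- all birational involutions, after conjugating them by very general members of the
    -- family, there is no non-trivial invariant at all
    (∃ (N a b : ℕ) (G H : Cremona.Forms n (MvPolynomial (Fin N) ℂ)),
      Cremona.IsBirationalFamily a b G H ∧
      ∀ (d : Fin ν → ℕ) (I : Fin ν → Cremona.Forms n ℂ),
        (∀ k, Cremona.IsInvolution (d k) (I k)) →
        (∀ s k, Cremona.IsInvolution (b * (d k * a)) (Cremona.conjugated G H I s k)) ∧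
        Cremona.VeryGeneral (fun s : Fin ν × Fin N → ℂ =>
          ∀ m, ¬ Cremona.HasNontrivialInvariant (Cremona.conjugated G H I s) m)) ∧
    -- the group generated by very general collineated copies of the Hadamard inversion
    -- has no non-trivial invariant
    Cremona.VeryGeneral (fun c : Fin ν × Fin (n + 1) × Fin (n + 1) → ℂ =>
      (∀ k, (Matrix.of fun i j => c (k, i, j)).det ≠ 0) ∧
      (∀ k, Cremona.IsInvolution n
        (Cremona.collineated (Cremona.hadamard n) (Matrix.of fun i j => c (k, i, j)))) ∧
      ∀ m, ¬ Cremona.HasNontrivialInvariant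
        (fun k => Cremona.collineated (Cremona.hadamard n) (Matrix.of fun i j => c (k, i, j))) m) := by
  exact ⟨Cremona.isZariskiClosed_hasNontrivialInvariant ν hn,
    Cremona.exists_family_veryGeneral_conjugated hn hν, Cremona.veryGeneral_collineated hn hν⟩
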